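/- Fix an optimal plain decompressor and an optimal prefix-free decompressor (partial computable functions from binary strings to natural numbers), with the resulting plain Kolmogorov complexity $C$ and prefix complexity $K$. Fix also an a priori probability $m$ on $\mathbb N$: a convergent lower semicomputable series of non-negative reals $m(k)$, maximal up to a multiplicative constant among such series. For $t\in\mathbb Z$ let $$B(t)=\max\{N\in\mathbb N: C(N)\le t\},\qquad BP(t)=\max\{N\in\mathbb N: K(N)\le t\},\qquad BP'(t)=\min\Big\{N\in\mathbb N:\sum_{k>N}m(k)<2^{-t}\Big\},$$ where $\max\varnothing=0$. A sequence of reals is lower (respectively upper) semicomputable if it is the pointwise limit $\lim_k q(n,k)$ of a total computable rational-valued function $q$ that is non-decreasing (respectively non-increasing) in $k$. Let $(a_n)_{n\in\mathbb N}$ be an upper semicomputable sequence of integers. Then the following eight conditions are equivalent (in 1–6, "for some constant $c\in\mathbb N$ and all $n\in\mathbb N$"): 1. $BP'(n)\le BP(n+a_n+c)$; 2. $B(n)\le BP'(n+a_n+c)$; 3. $B(n)\le BP(n+a_n+c)$; 4. $BP'(n-a_n)\le BP(n+c)$; 5. $B(n-a_n)\le BP'(n+c)$; 6. $B(n-a_n)\le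 BP(n+c)$; 7. $\sum_n 2^{-a_n}<+\infty$; 8. there is a constant $c\in\mathbb N$ such that $a_n\ge K(n)-c$ for all $n\in\mathbb N$. -/

import Mathlib

open Filter Topology

namespace BusyBeaver

/-- A total computable rational-valued function of two natural arguments: its values are
computed as fractions `(u - v) / (w + 1)` with natural `u`, `v`, `w`. -/
def ComputableRat (q : ℕ → ℕ → ℚ) : Prop :=
  ∃ u v w : ℕ → ℕ → ℕ, Computable₂ u ∧ Computable₂ v ∧ Computable₂ w ∧
    ∀ n k, q n k = ((u n k : ℚ) - (v n k : ℚ)) / ((w n k : ℚ) + 1)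

/-- A sequence of reals is lower semicomputable if it is the pointwise limit of a total
computable rational-valued function `q n k` that is non-decreasing in `k`. -/
def LowerSemicomputable (f : ℕ → ℝ) : Prop :=
  ∃ q : ℕ → ℕ → ℚ, ComputableRat q ∧ (∀ n, Monotone (q n)) ∧
    ∀ n, Tendsto (fun k => (q n k : ℝ)) atTop (𝓝 (f n))

/-- A sequence of reals is upper semicomputable if it is the pointwise limit of a total
computable rational-valued function `q n k` that is non-increasing in `k`. -/
def UpperSemicomputable (f : ℕ → ℝ) : Prop :=
  ∃ q : ℕ → ℕ → ℚ, ComputableRat q ∧ (∀ n, Antitone (q n)) ∧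
    ∀ n, Tendsto (fun k => (q n k : ℝ)) atTop (𝓝 (f n))

/-- Complexity of `x` with respect to the decompressor `D`: the minimal length of a binary
string `p` with `D p = x`, and `⊤` if there is none. -/
noncomputable def complexity (D : List Bool →. ℕ) (x : ℕ) : ℕ∞ :=
  ⨅ (p : List Bool) (_ : x ∈ D p), (p.length : ℕ∞)

/-- An optimal plain decompressor; `complexity D` is then plain Kolmogorov complexity. -/
def IsOptimalPlain (D : List Bool →. ℕ) : Prop :=
  Partrec D ∧ ∀ D' : List Bool →. ℕ, Partrec D' →
    ∃ c : ℕ, ∀ x, complexity D x ≤ complexity D' x + c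

/-- No string in the domain of `D` is a proper prefix of another string in the domain. -/
def PrefixFree (D : List Bool →. ℕ) : Prop :=
  ∀ p q : List Bool, (D p).Dom → (D q).Dom → p <+: q → p = q

/-- An optimal prefix-free decompressor; `complexity P` is then prefix Kolmogorov complexity. -/
def IsOptimalPrefix (P : List Bool →. ℕ) : Prop :=
  Partrec P ∧ PrefixFree P ∧ ∀ P' : List Bool →. ℕ, Partrec P' → PrefixFree P' →
    ∃ c : ℕ, ∀ x, complexity P x ≤ complexity P' x + c

/-- A priori probability: a lower semicomputable converging series of non-negative reals that
is maximal, up to a multiplicative constant, among all such series. -/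
def IsAPriori (m : ℕ → ℝ) : Prop :=
  ((∀ k, 0 ≤ m k) ∧ Summable m ∧ LowerSemicomputable m) ∧
    ∀ m' : ℕ → ℝ, (∀ k, 0 ≤ m' k) → Summable m' → LowerSemicomputable m' →
      ∃ C : ℝ, ∀ k, m' k ≤ C * m k

/-- The busy beaver function of a decompressor: the maximal number of complexity at most `t`.
The argument may be any integer; the maximum of the empty set is `0`. -/
noncomputable def busyBeaver (D : List Bool →. ℕ) (t : ℤ) : ℕ :=
  sSup {N : ℕ | ∃ k : ℕ, complexity D N = k ∧ (k : ℤ) ≤ t}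

/-- The modulus of convergence of the series `∑ m k`: the minimal `N` such that
`∑_{k > N} m k < 2 ^ (-t)`. -/
noncomputable def tailModulus (m : ℕ → ℝ) (t : ℤ) : ℕ :=
  sInf {N : ℕ | ∑' k : ℕ, m (N + 1 + k) < (2 : ℝ) ^ (-t)}

end BusyBeaver

open BusyBeaver

/-!
Requests for descriptions enumerated subject to the Kraft inequality are satisfied by `P` (Kraft and
Chaitin), and their weights are dominated by `m`. Hence `BP ≤ BP'` up to a shift of the argument,
and (7) gives (8). The first bits of the lower semicomputable real `∑ m k` determine a moment when
its approximation leaves little tail, hence `BP' ≤ B` up to a shift.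

If `K n ≤ a n + c`, then a plain program of length at most `n`, padded to a known length and
preceded by a prefix-free description of `n`, has a prefix-free description of length about
`n + a n`. This gives the inequalities 1–6.

For the converse, suppose that `X e ≤ Y (γ e)`, where the `γ e` can be computed as far as needed,
although `∑ 2 ^ (e - γ e)` diverges.
* If `X = B` and `Y = BP'`, cover `[0, ∑ m k]` by intervals, `2 ^ e` of them having the length
  `2 ^ (-γ e)`. For some `e`, then, `e` bits select the one containing `∑ m k`, so `B e` exceeds
  `BP' (γ e)`.
* If `X = BP'` and `Y = BP`, the Kraft inequality prevents `P` from having `2 ^ e` programs of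
  length at most `γ e` for every `e`. Measure the progress of `P` towards this by the minimum over
  `e` of `2 ^ (-e)` times the number of these programs found so far, and let `m` grow at each moment
  by the progress made. For the `e` attaining the minimum in the end, the progress after the moment
  `BP (γ e)` is at least `2 ^ (-e)`, so `BP' e` exceeds `BP (γ e)`.

Each argument loses an additive constant that is unknown in advance. A family of strategies is
therefore run in parallel, the `i`-th of them skipping the first `2 i + 1` terms of the series; the
`i`-th strategy defeats the constant `i`.
-/

namespace BusyBeaver

section Computability

variable {α β γ σ : Type*} [Primcodable α] [Primcodable β] [Primcodable γ] [Primcodable σ]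

/-- `Computable`, as a structure, so that `fun_prop` treats it as a function property and never
unfolds it. -/
@[fun_prop]
structure IsComputable (f : α → σ) : Prop where
  computable : Computable f

namespace IsComputable

protected theorem of_eq {f g : α → σ} (hf : IsComputable f) (h : ∀ a, f a = g a) :
    IsComputable g := ⟨hf.1.of_eq h⟩

theorem of_computable₂ {h : β → γ → σ} (hh : Computable₂ h) {f : α → β} {g : α → γ}
    (hf : IsComputable f) (hg : IsComputable g) : IsComputable fun a => h (f a) (g a) :=
  ⟨hh.comp hf.1 hg.1⟩

@[fun_prop]
protected theorem id : IsComputable fun a : α => a := ⟨Computable.id⟩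

@[fun_prop]
protected theorem const (x : σ) : IsComputable fun _ : α => x := ⟨Computable.const x⟩

@[fun_prop]
protected theorem comp {f : β → σ} {g : α → β} (hf : IsComputable f) (hg : IsComputable g) :
    IsComputable fun a => f (g a) := ⟨hf.1.comp hg.1⟩

@[fun_prop]
protected theorem fst {g : α → β × σ} (hg : IsComputable g) : IsComputable fun a => (g a).1 :=
  ⟨Computable.fst.comp hg.1⟩

@[fun_prop]
protected theorem snd {g : α → β × σ} (hg : IsComputable g) : IsComputable fun a => (g a).2 :=
  ⟨Computable.snd.comp hg.1⟩

@[fun_prop]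
protected theorem prodMk {g : α → β} {h : α → σ} (hg : IsComputable g) (hh : IsComputable h) :
    IsComputable fun a => (g a, h a) := ⟨hg.1.pair hh.1⟩

@[fun_prop]
protected theorem add {f g : α → ℕ} (hf : IsComputable f) (hg : IsComputable g) :
    IsComputable fun a => f a + g a := of_computable₂ Primrec.nat_add.to_comp hf hg

@[fun_prop]
protected theorem mul {f g : α → ℕ} (hf : IsComputable f) (hg : IsComputable g) :
    IsComputable fun a => f a * g a := of_computable₂ Primrec.nat_mul.to_comp hf hg

@[fun_prop]
protected theorem sub {f g : α → ℕ} (hf : IsComputable f) (hg : IsComputable g) :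
    IsComputable fun a => f a - g a := of_computable₂ Primrec.nat_sub.to_comp hf hg

@[fun_prop]
protected theorem unpair {f : α → ℕ} (hf : IsComputable f) :
    IsComputable fun a => Nat.unpair (f a) := ⟨Computable.unpair.comp hf.1⟩

@[fun_prop]
protected theorem decide_le {f g : α → ℕ} (hf : IsComputable f) (hg : IsComputable g) :
    IsComputable fun a => decide (f a ≤ g a) :=
  of_computable₂ Primrec.nat_le.decide.to_comp hf hg

@[fun_prop]
protected theorem decide_lt {f g : α → ℕ} (hf : IsComputable f) (hg : IsComputable g) :
    IsComputable fun a => decide (f a < g a) :=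
  of_computable₂ Primrec.nat_lt.decide.to_comp hf hg

@[fun_prop]
protected theorem decide_eq [DecidableEq β] {f g : α → β} (hf : IsComputable f)
    (hg : IsComputable g) : IsComputable fun a => decide (f a = g a) :=
  of_computable₂ Primrec.eq.decide.to_comp hf hg

@[fun_prop]
protected theorem decide_not {p : α → Prop} [DecidablePred p]
    (hp : IsComputable fun a => decide (p a)) : IsComputable fun a => decide (¬ p a) :=
  IsComputable.of_eq ⟨Primrec.not.to_comp.comp hp.1⟩ fun _ => (decide_not ..).symm

@[fun_prop]
protected theorem decide_and {p q : α → Prop} [DecidablePred p] [DecidablePred q]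
    (hp : IsComputable fun a => decide (p a)) (hq : IsComputable fun a => decide (q a)) :
    IsComputable fun a => decide (p a ∧ q a) :=
  (of_computable₂ Primrec.and.to_comp hp hq).of_eq fun _ => (Bool.decide_and ..).symm

@[fun_prop]
protected theorem ite {p : α → Prop} [DecidablePred p] {f g : α → σ}
    (hp : IsComputable fun a => decide (p a)) (hf : IsComputable f) (hg : IsComputable g) :
    IsComputable fun a => if p a then f a else g a :=
  IsComputable.of_eq ⟨Computable.cond hp.1 hf.1 hg.1⟩ fun _ => Bool.cond_decide ..

@[fun_prop]
protected theorem some {f : α → σ} (hf : IsComputable f) : IsComputable fun a => some (f a) :=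
  ⟨Computable.option_some.comp hf.1⟩

@[fun_prop]
protected theorem isSome {f : α → Option σ} (hf : IsComputable f) :
    IsComputable fun a => (f a).isSome := ⟨Primrec.option_isSome.to_comp.comp hf.1⟩

@[fun_prop]
protected theorem optionElim {f : α → Option β} {g : α → σ} {h : α → β → σ}
    (hf : IsComputable f) (hg : IsComputable g) (hh : IsComputable fun p : α × β => h p.1 p.2) :
    IsComputable fun a => (f a).elim (g a) (h a) :=
  IsComputable.of_eq ⟨Computable.option_casesOn hf.1 hg.1 hh.1.to₂⟩ fun a => by cases f a <;> rfl

@[fun_prop]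
protected theorem optionBind {f : α → Option β} {h : α → β → Option σ} (hf : IsComputable f)
    (hh : IsComputable fun p : α × β => h p.1 p.2) : IsComputable fun a => (f a).bind (h a) :=
  ⟨hf.1.option_bind hh.1.to₂⟩

@[fun_prop]
protected theorem encode {f : α → σ} (hf : IsComputable f) :
    IsComputable fun a => Encodable.encode (f a) := ⟨Computable.encode.comp hf.1⟩

@[fun_prop]
protected theorem decode {f : α → ℕ} (hf : IsComputable f) :
    IsComputable fun a => (Encodable.decode (f a) : Option σ) := ⟨Computable.decode.comp hf.1⟩

@[fun_prop]
protected theorem length {f : α → List σ} (hf : IsComputable f) :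
    IsComputable fun a => (f a).length := ⟨Computable.list_length.comp hf.1⟩

@[fun_prop]
protected theorem drop {n : α → ℕ} {f : α → List σ} (hn : IsComputable n) (hf : IsComputable f) :
    IsComputable fun a => (f a).drop (n a) := of_computable₂ Primrec.list_drop.to_comp hn hf

@[fun_prop]
protected theorem idxOf [DecidableEq σ] {x : α → σ} {f : α → List σ} (hx : IsComputable x)
    (hf : IsComputable f) : IsComputable fun a => (f a).idxOf (x a) :=
  of_computable₂ Primrec.list_idxOf.to_comp hx hf

@[fun_prop]
protected theorem natRec {f : α → ℕ} {g : α → σ} {h : α → ℕ → σ → σ} (hf : IsComputable f)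
    (hg : IsComputable g) (hh : IsComputable fun p : α × ℕ × σ => h p.1 p.2.1 p.2.2) :
    IsComputable fun a => Nat.rec (motive := fun _ => σ) (g a) (h a) (f a) :=
  ⟨Computable.nat_rec hf.1 hg.1 (h := fun a p => h a p.1 p.2) hh.1⟩

protected theorem find {p : α → ℕ → Prop} [∀ a, DecidablePred (p a)]
    (hp : IsComputable fun x : α × ℕ => decide (p x.1 x.2)) (h : ∀ a, ∃ n, p a n) :
    IsComputable fun a => Nat.find (h a) := by
  have hr : Partrec fun a => Nat.rfind fun n => (Part.some (decide (p a n)) : Part Bool) :=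
    Partrec.rfind (p := fun a n => Part.some (decide (p a n))) hp.1.partrec.to₂
  refine ⟨hr.of_eq_tot fun a => Nat.mem_rfind.2 ⟨?_, fun {k} hk => ?_⟩⟩
  · exact Part.mem_some_iff.2 (decide_eq_true (Nat.find_spec (h a))).symm
  · exact Part.mem_some_iff.2 (decide_eq_false (Nat.find_min (h a) hk)).symm

end IsComputable

end Computability

section RationalFunctions

variable {α β : Type*} [Primcodable α] [Primcodable β]

/-- A computable rational-valued function, on any encodable domain: its values are computed as
fractions `(u - v) / (w + 1)` of natural numbers, as in `ComputableRat`. -/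
@[fun_prop]
structure RatComputable (q : α → ℚ) : Prop where
  exists_fraction : ∃ u v w : α → ℕ, IsComputable u ∧ IsComputable v ∧ IsComputable w ∧
    ∀ a, q a = ((u a : ℚ) - (v a : ℚ)) / ((w a : ℚ) + 1)

theorem computableRat_iff {q : ℕ → ℕ → ℚ} :
    ComputableRat q ↔ RatComputable fun p : ℕ × ℕ => q p.1 p.2 := by
  constructor
  · rintro ⟨u, v, w, hu, hv, hw, h⟩
    exact ⟨_, _, _, ⟨hu⟩, ⟨hv⟩, ⟨hw⟩, fun a => h a.1 a.2⟩
  · rintro ⟨u, v, w, hu, hv, hw, h⟩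
    exact ⟨fun a b => u (a, b), fun a b => v (a, b), fun a b => w (a, b), hu.1.to₂, hv.1.to₂,
      hw.1.to₂, fun a b => h (a, b)⟩

namespace RatComputable

protected theorem of_eq {q r : α → ℚ} (hq : RatComputable q) (h : ∀ a, q a = r a) :
    RatComputable r := funext h ▸ hq

@[fun_prop]
protected theorem comp {q : β → ℚ} {f : α → β} (hq : RatComputable q) (hf : IsComputable f) :
    RatComputable fun a => q (f a) := by
  obtain ⟨u, v, w, hu, hv, hw, h⟩ := hq
  exact ⟨_, _, _, hu.comp hf, hv.comp hf, hw.comp hf, fun a => h (f a)⟩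

@[fun_prop]
protected theorem natCast {f : α → ℕ} (hf : IsComputable f) : RatComputable fun a => (f a : ℚ) :=
  ⟨f, fun _ => 0, fun _ => 0, hf, .const _, .const _, fun a => by simp⟩

@[fun_prop]
protected theorem const (r : ℚ) : RatComputable fun _ : α => r := by
  refine ⟨fun _ => r.num.toNat, fun _ => (-r.num).toNat, fun _ => r.den - 1, .const _, .const _,
    .const _, fun _ => ?_⟩
  have hnum : (r.num.toNat : ℚ) - ((-r.num).toNat : ℚ) = r.num := by
    exact_mod_cast (by omega : (r.num.toNat : ℤ) - ((-r.num).toNat : ℤ) = r.num)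
  rw [hnum, Nat.cast_pred r.den_pos, sub_add_cancel, Rat.num_div_den]

@[fun_prop]
protected theorem add {q r : α → ℚ} (hq : RatComputable q) (hr : RatComputable r) :
    RatComputable fun a => q a + r a := by
  obtain ⟨u, v, w, hu, hv, hw, h⟩ := hq
  obtain ⟨u', v', w', hu', hv', hw', h'⟩ := hr
  refine ⟨fun a => u a * (w' a + 1) + u' a * (w a + 1),
    fun a => v a * (w' a + 1) + v' a * (w a + 1), fun a => w a * w' a + w a + w' a,
    by fun_prop, by fun_prop, by fun_prop, fun a => ?_⟩
  rw [h, h', div_add_div _ _ (by positivity) (by positivity)]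
  push_cast
  congr 1 <;> ring

@[fun_prop]
protected theorem mul {q r : α → ℚ} (hq : RatComputable q) (hr : RatComputable r) :
    RatComputable fun a => q a * r a := by
  obtain ⟨u, v, w, hu, hv, hw, h⟩ := hq
  obtain ⟨u', v', w', hu', hv', hw', h'⟩ := hr
  refine ⟨fun a => u a * u' a + v a * v' a,
    fun a => v a * u' a + u a * v' a, fun a => w a * w' a + w a + w' a,
    by fun_prop, by fun_prop, by fun_prop, fun a => ?_⟩
  rw [h, h', div_mul_div_comm]
  push_cast
  congr 1 <;> ring

@[fun_prop]
protected theorem sub {q r : α → ℚ} (hq : RatComputable q) (hr : RatComputable r) :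
    RatComputable fun a => q a - r a := by
  have hneg : RatComputable fun a => q a + (-1) * r a := by fun_prop
  simpa only [neg_one_mul, ← sub_eq_add_neg] using hneg

@[fun_prop]
protected theorem decide_le {q r : α → ℚ} (hq : RatComputable q) (hr : RatComputable r) :
    IsComputable fun a => decide (q a ≤ r a) := by
  obtain ⟨u, v, w, hu, hv, hw, h⟩ := hq
  obtain ⟨u', v', w', hu', hv', hw', h'⟩ := hr
  have : IsComputable fun a => decide (u a * (w' a + 1) + v' a * (w a + 1) ≤
    u' a * (w a + 1) + v a * (w' a + 1)) := by fun_prop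
  refine this.of_eq fun a => ?_
  rw [decide_eq_decide, h, h', div_le_div_iff₀ (by positivity) (by positivity), sub_mul, sub_mul,
    sub_le_iff_le_add, sub_add_eq_add_sub, le_sub_iff_add_le]
  norm_cast

@[fun_prop]
protected theorem decide_lt {q r : α → ℚ} (hq : RatComputable q) (hr : RatComputable r) :
    IsComputable fun a => decide (q a < r a) :=
  (hr.decide_le hq).decide_not.of_eq fun _ => by simp only [not_le]

@[fun_prop]
protected theorem ite {p : α → Prop} [DecidablePred p] {q r : α → ℚ}
    (hp : IsComputable fun a => decide (p a)) (hq : RatComputable q) (hr : RatComputable r) :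
    RatComputable fun a => if p a then q a else r a := by
  obtain ⟨u, v, w, hu, hv, hw, h⟩ := hq
  obtain ⟨u', v', w', hu', hv', hw', h'⟩ := hr
  refine ⟨fun a => if p a then u a else u' a, fun a => if p a then v a else v' a,
    fun a => if p a then w a else w' a, by fun_prop, by fun_prop, by fun_prop, fun a => ?_⟩
  by_cases hpa : p a <;> simp [hpa, h, h']

@[fun_prop]
protected theorem min {q r : α → ℚ} (hq : RatComputable q) (hr : RatComputable r) :
    RatComputable fun a => min (q a) (r a) := by
  simp only [min_def]
  fun_prop

@[fun_prop]
protected theorem optionElim {f : α → Option β} {q : α → ℚ} {r : α → β → ℚ}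
    (hf : IsComputable f) (hq : RatComputable q) (hr : RatComputable fun p : α × β => r p.1 p.2) :
    RatComputable fun a => (f a).elim (q a) (r a) := by
  obtain ⟨u, v, w, hu, hv, hw, h⟩ := hq
  obtain ⟨u', v', w', hu', hv', hw', h'⟩ := hr
  refine ⟨fun a => (f a).elim (u a) fun b => u' (a, b),
    fun a => (f a).elim (v a) fun b => v' (a, b),
    fun a => (f a).elim (w a) fun b => w' (a, b), by fun_prop, by fun_prop, by fun_prop,
    fun a => ?_⟩
  rcases hfa : f a with _ | b
  · simpa [hfa] using h a
  · simpa [hfa] using h' (a, b)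

protected theorem natRec {n : α → ℕ} {g : α → ℚ} {h : α → ℕ → ℚ → ℚ} (hn : IsComputable n)
    (hg : RatComputable g)
    (hh : ∀ q : α × ℕ × (ℕ × ℕ × ℕ) → ℚ, RatComputable q →
      RatComputable fun p : α × ℕ × (ℕ × ℕ × ℕ) => h p.1 p.2.1 (q p)) :
    RatComputable fun a => Nat.rec (motive := fun _ => ℚ) (g a) (h a) (n a) := by
  obtain ⟨u, v, w, hu, hv, hw, hq⟩ := hg
  let val : ℕ × ℕ × ℕ → ℚ := fun t => ((t.1 : ℚ) - t.2.1) / (t.2.2 + 1)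
  have hval : RatComputable val := ⟨_, _, _, .fst .id, .fst (.snd .id), .snd (.snd .id),
    fun _ => rfl⟩
  obtain ⟨u', v', w', hu', hv', hw', hq'⟩ := hh (fun p => val p.2.2) (by fun_prop)
  let fraction : α → ℕ → ℕ × ℕ × ℕ := fun a k => Nat.rec (motive := fun _ => ℕ × ℕ × ℕ)
    (u a, v a, w a) (fun j t => (u' (a, j, t), v' (a, j, t), w' (a, j, t))) k
  have hfraction : IsComputable fun a => fraction a (n a) :=
    .natRec hn (by fun_prop) (by fun_prop)
  refine (hval.comp hfraction).of_eq fun a => ?_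
  induction n a with
  | zero => exact (hq a).symm
  | succ k ih => exact (hq' (a, k, _)).symm.trans (congrArg (h a k) ih)

@[fun_prop]
protected theorem pow {q : α → ℚ} {n : α → ℕ} (hq : RatComputable q) (hn : IsComputable n) :
    RatComputable fun a => q a ^ n a := by
  have h : RatComputable fun a => Nat.rec (motive := fun _ => ℚ) 1 (fun _ s => s * q a) (n a) :=
    .natRec hn (by fun_prop) fun q hq => by fun_prop
  refine h.of_eq fun a => ?_
  induction n a with
  | zero => exact (pow_zero _).symm
  | succ k ih => rw [pow_succ, ← ih]

@[fun_prop]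
protected theorem sum {n : α → ℕ} {f : α → ℕ → ℚ} (hn : IsComputable n)
    (hf : RatComputable fun p : α × ℕ => f p.1 p.2) :
    RatComputable fun a => ∑ j ∈ Finset.range (n a), f a j := by
  have h : RatComputable fun a => Nat.rec (motive := fun _ => ℚ) 0 (fun j s => s + f a j) (n a) :=
    .natRec hn (by fun_prop) fun q hq => by fun_prop
  refine h.of_eq fun a => ?_
  induction n a with
  | zero => rfl
  | succ k ih => rw [Finset.sum_range_succ, ← ih]

@[fun_prop]
protected theorem fold_min {n : α → ℕ} {g : α → ℚ} {f : α → ℕ → ℚ} (hn : IsComputable n)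
    (hg : RatComputable g) (hf : RatComputable fun p : α × ℕ => f p.1 p.2) :
    RatComputable fun a => (Finset.range (n a)).fold min (g a) (f a) := by
  have h : RatComputable fun a =>
      Nat.rec (motive := fun _ => ℚ) (g a) (fun j s => min (f a j) s) (n a) :=
    .natRec hn hg fun q hq => by fun_prop
  refine h.of_eq fun a => ?_
  induction n a with
  | zero => rfl
  | succ k ih => rw [Finset.range_add_one, Finset.fold_insert Finset.notMem_range_self, ← ih]

end RatComputable

end RationalFunctions

section Enumerations

variable {ι κ : Type*} [Primcodable ι] [Primcodable κ] {R : ι → Prop}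

theorem rePred_exists {p : ι → ℕ → Prop} [∀ i, DecidablePred (p i)]
    (hp : IsComputable fun x : ι × ℕ => decide (p x.1 x.2)) : REPred fun i => ∃ k, p i k := by
  have hsearch : IsComputable fun x : ι × ℕ => if p x.1 x.2 then some () else none := by fun_prop
  refine (Partrec.rfindOpt hsearch.1.to₂).dom_re.of_eq fun i => Nat.rfindOpt_dom.trans ?_
  simp

theorem rePred_mem {D : ι →. κ} (hD : Partrec D) : REPred fun x : ι × κ => x.2 ∈ D x.1 := by
  have hcheck : IsComputable fun z : (ι × κ) × κ =>
      if Encodable.encode z.2 = Encodable.encode z.1.2 then some () else none := by fun_prop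
  refine ((hD.comp Computable.fst).bind (Computable.ofOption hcheck.1).to₂).dom_re.of_eq
    fun x => ?_
  simp [Part.dom_iff_mem]

/-- The step-by-step listing of a recursively enumerable set without repetitions: `enum t` is the
element listed at time `t`, if there is one. Elements are never listed before the time given by
their code, so what is listed by a given time is bounded. -/
structure IsEnumeration (R : ι → Prop) (enum : ℕ → Option ι) : Prop where
  computable : IsComputable enum
  mem_iff : ∀ i, R i ↔ ∃ t, enum t = some i
  encode_le : ∀ {t i}, enum t = some i → Encodable.encode i ≤ t
  injective : ∀ {s t i}, enum s = some i → enum t = some i → s = t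

theorem exists_computable_stages (hR : REPred R) :
    ∃ found : ι → ℕ → Bool, (IsComputable fun x : ι × ℕ => found x.1 x.2) ∧
      (∀ i, Monotone (found i)) ∧ (∀ i, found i 0 = false) ∧ ∀ i, R i ↔ ∃ k, found i k := by
  obtain ⟨c, hc⟩ := Nat.Partrec.Code.exists_code.1 hR
  refine ⟨fun i k => (Nat.Partrec.Code.evaln k c (Encodable.encode i)).isSome, ?_, ?_, ?_, ?_⟩
  · exact .isSome ⟨Nat.Partrec.Code.primrec_evaln.to_comp.comp
      ((Computable.snd.pair (.const c)).pair (Computable.encode.comp .fst))⟩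
  · refine fun i j k hjk => Bool.le_iff_imp.2 fun h => ?_
    obtain ⟨x, hx⟩ := Option.isSome_iff_exists.1 h
    exact Option.isSome_iff_exists.2 ⟨x, Nat.Partrec.Code.evaln_mono hjk hx⟩
  · simp [Nat.Partrec.Code.evaln]
  · intro i
    simp_rw [Option.isSome_iff_exists, ← Option.mem_def]
    rw [exists_comm]
    simp_rw [← Nat.Partrec.Code.evaln_complete]
    simp [hc]

theorem exists_isEnumeration (hR : REPred R) : ∃ enum, IsEnumeration R enum := by
  obtain ⟨found, hfound, found_mono, found_zero, found_iff⟩ := exists_computable_stages hR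
  let enum : ℕ → Option ι := fun t => (Encodable.decode t.unpair.1 : Option ι).bind fun i =>
    if Encodable.encode i = t.unpair.1 ∧ found i t.unpair.2 = false ∧
      found i (t.unpair.2 + 1) = true then some i else none
  have enum_eq {t i} : enum t = some i ↔ Encodable.encode i = t.unpair.1 ∧
      found i t.unpair.2 = false ∧ found i (t.unpair.2 + 1) = true := by
    simp only [enum, Option.bind_eq_some_iff, Option.ite_none_right_eq_some, Option.some.injEq]
    refine ⟨fun ⟨_, _, h, rfl⟩ => h, fun h => ⟨i, ?_, h, rfl⟩⟩
    rw [← h.1, Encodable.encodek]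
  refine ⟨enum, by fun_prop, fun i => ?_, fun {t i} h => ?_, fun {s t i} hs ht => ?_⟩
  · rw [found_iff]
    refine ⟨fun h => ?_, fun ⟨t, ht⟩ => ⟨_, (enum_eq.1 ht).2.2⟩⟩
    obtain ⟨k, hk⟩ : ∃ k, Nat.find h = k + 1 := Nat.exists_eq_succ_of_ne_zero fun h0 => by
      simpa [h0, found_zero] using Nat.find_spec h
    refine ⟨Nat.pair (Encodable.encode i) k, enum_eq.2 ?_⟩
    rw [Nat.unpair_pair]
    exact ⟨rfl, Bool.eq_false_of_not_eq_true (Nat.find_min h (by omega)), hk ▸ Nat.find_spec h⟩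
  · rw [(enum_eq.1 h).1]
    exact Nat.unpair_left_le t
  · obtain ⟨hs₁, hs₂, hs₃⟩ := enum_eq.1 hs
    obtain ⟨ht₁, ht₂, ht₃⟩ := enum_eq.1 ht
    have le_of_found {j k} (hj : found i j = false) (hk : found i (k + 1) = true) : j ≤ k := by
      by_contra! hkj
      exact absurd (Bool.le_iff_imp.1 (found_mono i hkj) hk) (by simp [hj])
    rw [← Nat.pair_unpair s, ← Nat.pair_unpair t, ← hs₁, ← ht₁,
      (le_of_found hs₂ ht₃).antisymm (le_of_found ht₂ hs₃)]

namespace IsEnumeration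

variable {enum : ℕ → Option ι}

/-- The elements listed before time `s`. -/
def listed (h : IsEnumeration R enum) (s : ℕ) : Finset ι :=
  (Finset.range s).filterMap enum fun _ _ _ => h.injective

theorem mem_listed (h : IsEnumeration R enum) {s : ℕ} {i : ι} :
    i ∈ h.listed s ↔ ∃ t < s, enum t = some i := by
  simp [listed]

theorem of_mem_listed (h : IsEnumeration R enum) {s : ℕ} {i : ι} (hi : i ∈ h.listed s) : R i :=
  let ⟨t, _, ht⟩ := h.mem_listed.1 hi
  (h.mem_iff i).2 ⟨t, ht⟩

theorem listed_mono (h : IsEnumeration R enum) : Monotone h.listed := fun _ _ hs _ hi =>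
  let ⟨t, ht, hti⟩ := h.mem_listed.1 hi
  h.mem_listed.2 ⟨t, ht.trans_le hs, hti⟩

theorem sum_listed {M : Type*} [AddCommMonoid M] (h : IsEnumeration R enum) (F : ι → M) (s : ℕ) :
    ∑ i ∈ h.listed s, F i = ∑ t ∈ Finset.range s, (enum t).elim 0 F := by
  classical
  induction s with
  | zero => simp [listed]
  | succ s ih =>
    have mem_succ {i} : i ∈ h.listed (s + 1) ↔ i ∈ h.listed s ∨ enum s = some i := by
      simp only [mem_listed, Nat.lt_succ_iff_lt_or_eq, or_and_right, exists_or, exists_eq_left]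
    rw [Finset.sum_range_succ, ← ih]
    rcases hs : enum s with _ | i
    · rw [Option.elim_none, add_zero]
      exact Finset.sum_congr (Finset.ext fun j => by simp [mem_succ, hs]) fun _ _ => rfl
    · have hi : i ∉ h.listed s := fun hi => by
        obtain ⟨t, ht, hti⟩ := h.mem_listed.1 hi
        exact ht.ne (h.injective hti hs)
      have hinsert : h.listed (s + 1) = insert i (h.listed s) := by
        ext j
        rw [mem_succ, hs, Finset.mem_insert, Option.some.injEq, or_comm, eq_comm]
      rw [hinsert, Finset.sum_insert hi, add_comm, Option.elim_some]

@[fun_prop]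
theorem ratComputable_sum_listed {α : Type*} [Primcodable α] (h : IsEnumeration R enum)
    {F : α → ι → ℚ} {s : α → ℕ} (hs : IsComputable s)
    (hF : RatComputable fun x : α × ι => F x.1 x.2) :
    RatComputable fun a => ∑ i ∈ h.listed (s a), F a i := by
  have := h.computable
  simp only [sum_listed]
  fun_prop

end IsEnumeration

theorem rePred_and {Q : ι → Prop} (hR : REPred R) (hQ : REPred Q) :
    REPred fun i => R i ∧ Q i := by
  refine (hR.bind (hQ.comp Computable.fst).to₂).dom_re.of_eq fun i => ?_
  simp [Part.assert, Part.bind]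

theorem rePred_comp {f : κ → ι} (hR : REPred R) (hf : IsComputable f) :
    REPred fun x => R (f x) := Partrec.comp hR hf.1

theorem rePred_of_decide {p : ι → Prop} [DecidablePred p]
    (hp : IsComputable fun i => decide (p i)) : REPred p :=
  ComputablePred.to_re ⟨inferInstance, hp.1⟩

end Enumerations

section BinaryFractions

/-- The dyadic rational `0.w` with the binary expansion `w`. The strings extending `w` are those
whose dyadic interval `[0.v, 0.v + 2 ^ (-|v|)]` is contained in that of `w`. -/
def binaryFraction : List Bool → ℚ
  | [] => 0
  | b :: w => ((if b = true then 1 else 0) + binaryFraction w) / 2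

theorem binaryFraction_eq_sum (w : List Bool) : binaryFraction w =
    ∑ j ∈ Finset.range w.length, if w[j]? = some true then (1 / 2 : ℚ) ^ (j + 1) else 0 := by
  induction w with
  | nil => rfl
  | cons b w ih =>
    rw [binaryFraction, ih, List.length_cons, Finset.sum_range_succ', add_div, add_comm,
      Finset.sum_div]
    congr 1
    · refine Finset.sum_congr rfl fun j _ => ?_
      rw [List.getElem?_cons_succ, pow_succ _ (j + 1)]
      split_ifs <;> ring
    · cases b <;> norm_num

@[fun_prop]
theorem ratComputable_binaryFraction {α : Type*} [Primcodable α] {w : α → List Bool}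
    (hw : IsComputable w) : RatComputable fun a => binaryFraction (w a) := by
  have hget : IsComputable fun x : List Bool × ℕ => x.1[x.2]? :=
    ⟨Computable.list_getElem?.comp .fst .snd⟩
  refine RatComputable.comp (q := binaryFraction)
    (.of_eq ?_ fun w => (binaryFraction_eq_sum w).symm) hw
  fun_prop

theorem binaryFraction_append (v w : List Bool) :
    binaryFraction (v ++ w) = binaryFraction v + (1 / 2) ^ v.length * binaryFraction w := by
  induction v with
  | nil => simp [binaryFraction]
  | cons b v ih =>
    rw [List.cons_append, binaryFraction, binaryFraction, ih, List.length_cons, pow_succ]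
    ring

theorem binaryFraction_nonneg (w : List Bool) : 0 ≤ binaryFraction w := by
  induction w with
  | nil => rfl
  | cons b w ih =>
    rw [binaryFraction]
    split_ifs <;> positivity

theorem binaryFraction_lt_one (w : List Bool) : binaryFraction w < 1 := by
  induction w with
  | nil => exact one_pos
  | cons b w ih =>
    rw [binaryFraction]
    split_ifs <;> linarith

theorem binaryFraction_le_of_prefix {v w : List Bool} (h : v <+: w) :
    binaryFraction v ≤ binaryFraction w := by
  obtain ⟨u, rfl⟩ := h
  rw [binaryFraction_append]
  exact le_add_of_nonneg_right (mul_nonneg (by positivity) (binaryFraction_nonneg u))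

theorem binaryFraction_lt_of_prefix {v w : List Bool} (h : v <+: w) :
    binaryFraction w < binaryFraction v + (1 / 2) ^ v.length := by
  obtain ⟨u, rfl⟩ := h
  rw [binaryFraction_append]
  exact add_lt_add_right (mul_lt_of_lt_one_right (by positivity) (binaryFraction_lt_one u)) _

theorem exists_binaryFraction_lt_le {x : ℝ} (hx₀ : 0 < x) (hx₁ : x ≤ 1) (n : ℕ) :
    ∃ w : List Bool, w.length = n ∧ binaryFraction w < x ∧
      x ≤ binaryFraction w + (1 / 2) ^ n := by
  induction n generalizing x with
  | zero => exact ⟨[], rfl, by simpa [binaryFraction], by simpa [binaryFraction]⟩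
  | succ n ih =>
    rcases le_or_gt x (1 / 2) with hx | hx
    · obtain ⟨w, hw, hlt, hle⟩ := ih (x := 2 * x) (by linarith) (by linarith)
      refine ⟨false :: w, by simp [hw], ?_⟩
      simp only [binaryFraction, pow_succ, Bool.false_eq_true, if_false]
      push_cast
      constructor <;> linarith
    · obtain ⟨w, hw, hlt, hle⟩ := ih (x := 2 * x - 1) (by linarith) (by linarith)
      refine ⟨true :: w, by simp [hw], ?_⟩
      simp only [binaryFraction, pow_succ, if_true]
      push_cast
      constructor <;> linarith

end BinaryFractions

section Complexity

variable {D : List Bool →. ℕ} {x : ℕ}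

theorem complexity_le {p : List Bool} (h : x ∈ D p) : complexity D x ≤ p.length :=
  iInf₂_le p h

theorem complexity_le_iff {k : ℕ} :
    complexity D x ≤ k ↔ ∃ p, x ∈ D p ∧ p.length ≤ k := by
  refine ⟨fun h => ?_, fun ⟨p, hp, hk⟩ => (complexity_le hp).trans (by exact_mod_cast hk)⟩
  by_contra! hc
  have hlt : ((k + 1 : ℕ) : ℕ∞) ≤ complexity D x :=
    le_iInf₂ fun p hp => by exact_mod_cast hc p hp
  exact absurd (hlt.trans h) (by norm_cast; omega)

theorem exists_complexity_eq_and_le_iff {t : ℤ} :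
    (∃ k : ℕ, complexity D x = k ∧ (k : ℤ) ≤ t) ↔ ∃ p, x ∈ D p ∧ (p.length : ℤ) ≤ t := by
  constructor
  · rintro ⟨k, hk, hkt⟩
    obtain ⟨p, hp, hpk⟩ := complexity_le_iff.1 hk.le
    exact ⟨p, hp, by omega⟩
  · rintro ⟨p, hp, hpt⟩
    obtain ⟨k, hk⟩ := ENat.ne_top_iff_exists.1
      (ne_top_of_le_ne_top (ENat.natCast_ne_top _) (complexity_le hp))
    have hkp : k ≤ p.length := by exact_mod_cast hk.trans_le (complexity_le hp)
    exact ⟨k, hk.symm, by omega⟩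

theorem finite_setOf_output (D : List Bool →. ℕ) (t : ℤ) :
    {N : ℕ | ∃ p, N ∈ D p ∧ (p.length : ℤ) ≤ t}.Finite := by
  have hprograms : {p : List Bool | p.length ≤ t.toNat}.Finite := List.finite_length_le _ _
  refine (hprograms.biUnion fun p _ => Set.Subsingleton.finite
    (s := {N | N ∈ D p}) fun _ h _ h' => Part.mem_unique h h').subset ?_
  rintro N ⟨p, hN, hp⟩
  exact Set.mem_biUnion (Int.le_toNat (by omega) |>.2 hp) hN

theorem busyBeaver_eq (D : List Bool →. ℕ) (t : ℤ) :
    busyBeaver D t = sSup {N : ℕ | ∃ p, N ∈ D p ∧ (p.length : ℤ) ≤ t} := by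
  simp only [busyBeaver, exists_complexity_eq_and_le_iff]

theorem le_busyBeaver {p : List Bool} {t : ℤ} (h : x ∈ D p) (hp : (p.length : ℤ) ≤ t) :
    x ≤ busyBeaver D t := by
  rw [busyBeaver_eq]
  exact le_csSup (finite_setOf_output D t).bddAbove ⟨p, h, hp⟩

theorem busyBeaver_mem_or_eq_zero (D : List Bool →. ℕ) (t : ℤ) :
    (∃ p, busyBeaver D t ∈ D p ∧ (p.length : ℤ) ≤ t) ∨ busyBeaver D t = 0 := by
  rw [busyBeaver_eq]
  rcases Set.eq_empty_or_nonempty {N : ℕ | ∃ p, N ∈ D p ∧ (p.length : ℤ) ≤ t} with h | h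
  · exact .inr (by rw [h, csSup_empty]; rfl)
  · exact .inl (Nat.sSup_mem h (finite_setOf_output D t).bddAbove)

theorem busyBeaver_le {t : ℤ} {M : ℕ}
    (h : ∀ N p, N ∈ D p → (p.length : ℤ) ≤ t → N ≤ M) : busyBeaver D t ≤ M := by
  rcases busyBeaver_mem_or_eq_zero D t with ⟨p, hp, hl⟩ | h0
  · exact h _ p hp hl
  · omega

theorem busyBeaver_mono {s t : ℤ} (h : s ≤ t) : busyBeaver D s ≤ busyBeaver D t :=
  busyBeaver_le fun _ _ hN hp => le_busyBeaver hN (hp.trans h)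

theorem exists_program_of_complexity_le_add {D' : List Bool →. ℕ} {c : ℕ} {p : List Bool}
    (h : complexity D x ≤ complexity D' x + c) (hp : x ∈ D' p) :
    ∃ q, x ∈ D q ∧ q.length ≤ p.length + c :=
  complexity_le_iff.1 (h.trans (by push_cast; gcongr; exact complexity_le hp))

theorem IsOptimalPlain.exists_program (hD : IsOptimalPlain D) {D' : List Bool →. ℕ}
    (h : Partrec D') : ∃ c : ℕ, ∀ x p, x ∈ D' p → ∃ q, x ∈ D q ∧ q.length ≤ p.length + c :=
  let ⟨c, hc⟩ := hD.2 D' h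
  ⟨c, fun x _ hp => exists_program_of_complexity_le_add (hc x) hp⟩

theorem IsOptimalPrefix.exists_program (hD : IsOptimalPrefix D) {D' : List Bool →. ℕ}
    (h : Partrec D') (h' : PrefixFree D') :
    ∃ c : ℕ, ∀ x p, x ∈ D' p → ∃ q, x ∈ D q ∧ q.length ≤ p.length + c :=
  let ⟨c, hc⟩ := hD.2.2 D' h h'
  ⟨c, fun x _ hp => exists_program_of_complexity_le_add (hc x) hp⟩

end Complexity

section PrefixFreeCodes

theorem uniquelyDecodable_of_prefixFree {α : Type*} {S : Set (List α)} (hnil : [] ∉ S)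
    (hS : ∀ p ∈ S, ∀ q ∈ S, p <+: q → p = q) : InformationTheory.UniquelyDecodable S := by
  intro L₁
  induction L₁ with
  | nil =>
    rintro (_ | ⟨w, L₂⟩) - h₂ h
    · rfl
    · obtain ⟨rfl, -⟩ := List.append_eq_nil_iff.1 (h.symm : w ++ L₂.flatten = [])
      exact absurd (h₂ _ (by simp)) hnil
  | cons v L₁ ih =>
    rintro (_ | ⟨w, L₂⟩) h₁ h₂ h
    · obtain ⟨rfl, -⟩ := List.append_eq_nil_iff.1 (h : v ++ L₁.flatten = [])
      exact absurd (h₁ _ (by simp)) hnil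
    · rw [List.forall_mem_cons] at h₁ h₂
      rw [List.flatten_cons, List.flatten_cons] at h
      have hvw : v = w := by
        rcases List.prefix_or_prefix_of_prefix (List.prefix_append v _)
          (h ▸ List.prefix_append w _) with hp | hp
        · exact hS _ h₁.1 _ h₂.1 hp
        · exact (hS _ h₂.1 _ h₁.1 hp).symm
      subst hvw
      rw [ih _ h₁.2 h₂.2 (List.append_cancel_left h)]

theorem sum_half_pow_length_le_one {S : Finset (List Bool)}
    (hS : ∀ p ∈ S, ∀ q ∈ S, p <+: q → p = q) : ∑ p ∈ S, (1 / 2 : ℚ) ^ p.length ≤ 1 := by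
  by_cases hnil : [] ∈ S
  · rw [Finset.eq_singleton_iff_unique_mem.2 ⟨hnil, fun p hp => (hS _ hnil p hp p.nil_prefix).symm⟩]
    simp
  · have hkraft := InformationTheory.kraft_mcmillan_inequality
      (uniquelyDecodable_of_prefixFree (by exact_mod_cast hnil) (by exact_mod_cast hS))
    rw [Fintype.card_bool] at hkraft
    exact (Rat.cast_le (K := ℝ)).1 (by push_cast; exact_mod_cast hkraft)

end PrefixFreeCodes

section TailModulus

variable {m : ℕ → ℝ}

theorem sum_range_add_tail (hm : Summable m) (N : ℕ) :
    ∑ k ∈ Finset.range N, m k + ∑' k, m (N + k) = ∑' k, m k := by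
  simpa only [add_comm N] using hm.sum_add_tsum_nat_add N

theorem summable_tail (hm : Summable m) (N : ℕ) : Summable fun k => m (N + k) := by
  simpa only [add_comm N] using (summable_nat_add_iff N).2 hm

theorem antitone_tail (h0 : ∀ k, 0 ≤ m k) (hm : Summable m) :
    Antitone fun N => ∑' k, m (N + k) := fun M N h => by
  have hsum := Finset.sum_le_sum_of_subset_of_nonneg (Finset.range_subset_range.2 h)
    fun k _ _ => h0 k
  linarith [sum_range_add_tail hm M, sum_range_add_tail hm N]

theorem tailModulus_le {t : ℤ} {N : ℕ} (h : ∑' k, m (N + 1 + k) < (2 : ℝ) ^ (-t)) :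
    tailModulus m t ≤ N := Nat.sInf_le h

theorem tail_tailModulus_lt (m : ℕ → ℝ) (t : ℤ) :
    ∑' k, m (tailModulus m t + 1 + k) < (2 : ℝ) ^ (-t) := by
  have htail := (tendsto_sum_nat_add m).comp (tendsto_add_atTop_nat 1)
  obtain ⟨N, hN⟩ := (htail.eventually (gt_mem_nhds (show (0 : ℝ) < 2 ^ (-t) by positivity))).exists
  exact Nat.sInf_mem (s := {N : ℕ | ∑' k : ℕ, m (N + 1 + k) < (2 : ℝ) ^ (-t)})
    ⟨N, by simpa [add_comm] using hN⟩

theorem lt_tailModulus (h0 : ∀ k, 0 ≤ m k) (hm : Summable m) {t : ℤ} {N : ℕ}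
    (h : (2 : ℝ) ^ (-t) ≤ ∑' k, m (N + 1 + k)) : N < tailModulus m t := by
  by_contra! hc
  exact absurd (tail_tailModulus_lt m t)
    (h.trans (antitone_tail h0 hm (Nat.add_le_add_right hc 1))).not_gt

theorem tailModulus_mono (m : ℕ → ℝ) {s t : ℤ} (h : s ≤ t) :
    tailModulus m s ≤ tailModulus m t :=
  tailModulus_le ((tail_tailModulus_lt m t).trans_le
    (zpow_le_zpow_right₀ one_le_two (by omega)))

theorem IsAPriori.exists_le_mul (hm : IsAPriori m) {q : ℕ → ℕ → ℚ}
    (hq : RatComputable fun x : ℕ × ℕ => q x.1 x.2) (hmono : ∀ x, Monotone (q x))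
    (h0 : ∀ x k, 0 ≤ q x k) (hsum : ∀ N k, ∑ x ∈ Finset.range N, q x k ≤ 1) :
    ∃ c : ℕ, ∀ x k, (q x k : ℝ) ≤ 2 ^ c * m x := by
  have hbdd : ∀ x, BddAbove (Set.range fun k => (q x k : ℝ)) := fun x => by
    refine ⟨1, Set.forall_mem_range.2 fun k => ?_⟩
    exact_mod_cast (Finset.single_le_sum (f := (q · k)) (fun x _ => h0 x k)
      (Finset.self_mem_range_succ x)).trans (hsum (x + 1) k)
  have hlim : ∀ x, Tendsto (fun k => (q x k : ℝ)) atTop (𝓝 (⨆ k, (q x k : ℝ))) := fun x =>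
    tendsto_atTop_ciSup (fun _ _ h => Rat.cast_le.2 (hmono x h)) (hbdd x)
  have hlim_nonneg : ∀ x, 0 ≤ ⨆ k, (q x k : ℝ) := fun x =>
    ge_of_tendsto' (hlim x) fun k => by exact_mod_cast h0 x k
  have hlim_summable : Summable fun x => ⨆ k, (q x k : ℝ) :=
    summable_of_sum_range_le (c := 1) hlim_nonneg fun N =>
      le_of_tendsto' (tendsto_finsetSum _ fun x _ => hlim x) fun k => by exact_mod_cast hsum N k
  obtain ⟨C, hC⟩ := hm.2 _ hlim_nonneg hlim_summable ⟨q, computableRat_iff.2 hq, hmono, hlim⟩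
  obtain ⟨c, hc⟩ := pow_unbounded_of_one_lt C one_lt_two
  exact ⟨c, fun x k => ((le_ciSup (hbdd x) k).trans (hC x)).trans
    (mul_le_mul_of_nonneg_right hc.le (hm.1.1 x))⟩

end TailModulus

section Requests

variable {ι : Type*} {R : ι → Prop} {len out : ι → ℕ} {P : List Bool →. ℕ} {m : ℕ → ℝ}

/-- The part of the unit interval taken by the requests listed before time `t`. -/
def allocated (len : ι → ℕ) (enum : ℕ → Option ι) (t : ℕ) : ℚ :=
  ∑ j ∈ Finset.range t, (enum j).elim 0 fun i => (1 / 2) ^ len i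

theorem monotone_allocated (len : ι → ℕ) (enum : ℕ → Option ι) : Monotone (allocated len enum) :=
  fun _ _ h => Finset.sum_le_sum_of_subset_of_nonneg (Finset.range_subset_range.2 h) fun j _ _ => by
    cases enum j <;> simp only [Option.elim_none, Option.elim_some] <;> positivity

/-- The Kraft–Chaitin machine: a string is a program for the request `i` listed at time `t` if it
has length `len i + 1` and its dyadic interval lies inside the interval allocated to `i`. Every
interval of length `2 ^ (-l)` contains a dyadic interval of length `2 ^ (-(l + 1))`. -/
def requestMachine (len out : ι → ℕ) (enum : ℕ → Option ι) (w : List Bool) (t : ℕ) : Option ℕ :=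
  (enum t).bind fun i => if w.length = len i + 1 ∧ allocated len enum t ≤ binaryFraction w ∧
    binaryFraction w + (1 / 2) ^ w.length ≤ allocated len enum (t + 1) then some (out i) else none

theorem requestMachine_eq_some {enum : ℕ → Option ι} {w : List Bool} {t y : ℕ} :
    requestMachine len out enum w t = some y ↔ ∃ i, enum t = some i ∧ w.length = len i + 1 ∧
      allocated len enum t ≤ binaryFraction w ∧
      binaryFraction w + (1 / 2) ^ w.length ≤ allocated len enum (t + 1) ∧ out i = y := by
  simp only [requestMachine, Option.bind_eq_some_iff, Option.ite_none_right_eq_some,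
    Option.some.injEq, and_assoc]

theorem requestMachine_prefix {enum : ℕ → Option ι} {w w' : List Bool} {t t' y y' : ℕ}
    (h : requestMachine len out enum w t = some y)
    (h' : requestMachine len out enum w' t' = some y') (hw : w <+: w') : w = w' ∧ y = y' := by
  obtain ⟨i, hi, hlen, hlow, hup, rfl⟩ := requestMachine_eq_some.1 h
  obtain ⟨i', hi', hlen', hlow', hup', rfl⟩ := requestMachine_eq_some.1 h'
  have hmono := monotone_allocated len enum
  have hleft : binaryFraction w ≤ binaryFraction w' := binaryFraction_le_of_prefix hw
  have hright : binaryFraction w' < binaryFraction w + (1 / 2) ^ w.length :=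
    binaryFraction_lt_of_prefix hw
  have hpos : (0 : ℚ) < (1 / 2) ^ w'.length := by positivity
  have htt' : t = t' := by
    rcases lt_trichotomy t t' with hlt | heq | hgt
    · linarith [hmono (Nat.succ_le_of_lt hlt)]
    · exact heq
    · linarith [hmono (Nat.succ_le_of_lt hgt)]
  subst htt'
  obtain rfl : i = i' := Option.some.inj (hi.symm.trans hi')
  exact ⟨hw.eq_of_length (hlen.trans hlen'.symm), rfl⟩

variable [Primcodable ι]

/-- A recursively enumerable set of requests, as in the Kraft–Chaitin theorem: the request `i`
asks for a description of length `len i` of the number `out i`, and the requested lengths satisfy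
the Kraft inequality. -/
structure IsRequestSet (R : ι → Prop) (len out : ι → ℕ) : Prop where
  rePred : REPred R
  computable_len : IsComputable len
  computable_out : IsComputable out
  kraft : ∀ S : Finset ι, (∀ i ∈ S, R i) → ∑ i ∈ S, (1 / 2 : ℚ) ^ len i ≤ 1

theorem IsOptimalPrefix.exists_program_of_search (hP : IsOptimalPrefix P)
    {F : List Bool → ℕ → Option ℕ} (hF : IsComputable fun x : List Bool × ℕ => F x.1 x.2)
    (hprefix : ∀ {w w' t t' y y'}, F w t = some y → F w' t' = some y' → w <+: w' →
      w = w' ∧ y = y') :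
    ∃ c : ℕ, ∀ w t y, F w t = some y → ∃ q, y ∈ P q ∧ q.length ≤ w.length + c := by
  obtain ⟨c, hc⟩ := hP.exists_program (D' := fun w => Nat.rfindOpt (F w))
    (Partrec.rfindOpt hF.1.to₂) fun w w' hw hw' hpre => by
      obtain ⟨t, y, ht⟩ := Nat.rfindOpt_dom.1 hw
      obtain ⟨t', y', ht'⟩ := Nat.rfindOpt_dom.1 hw'
      exact (hprefix ht ht' hpre).1
  refine ⟨c, fun w t y ht => hc y w ?_⟩
  obtain ⟨y', hy'⟩ := Part.dom_iff_mem.1 (Nat.rfindOpt_dom.2 ⟨t, y, ht⟩)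
  obtain ⟨t', ht'⟩ := Nat.rfindOpt_spec hy'
  rwa [(hprefix ht ht' (List.prefix_refl w)).2]

theorem IsRequestSet.allocated_le_one (h : IsRequestSet R len out) {enum : ℕ → Option ι}
    (henum : IsEnumeration R enum) (t : ℕ) : allocated len enum t ≤ 1 := by
  rw [allocated, ← henum.sum_listed]
  exact h.kraft _ fun i => henum.of_mem_listed

theorem IsRequestSet.exists_program (h : IsRequestSet R len out) (hP : IsOptimalPrefix P) :
    ∃ c : ℕ, ∀ i, R i → ∃ q, out i ∈ P q ∧ q.length ≤ len i + c := by
  obtain ⟨enum, henum⟩ := exists_isEnumeration h.rePred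
  have := henum.computable
  have := h.computable_len
  have := h.computable_out
  obtain ⟨c, hc⟩ := hP.exists_program_of_search (F := requestMachine len out enum)
    (by unfold requestMachine allocated; fun_prop) requestMachine_prefix
  refine ⟨c + 1, fun i hi => ?_⟩
  obtain ⟨t, ht⟩ := (henum.mem_iff i).1 hi
  have hnonneg : 0 ≤ allocated len enum t := monotone_allocated len enum t.zero_le
  have hsucc : allocated len enum (t + 1) = allocated len enum t + (1 / 2) ^ len i := by
    rw [allocated, Finset.sum_range_succ, ht]; rfl
  have hle := h.allocated_le_one henum (t + 1)
  have hhalf : (1 / 2 : ℚ) ^ len i = (1 / 2) ^ (len i + 1) + (1 / 2) ^ (len i + 1) := by ring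
  have hpos : (0 : ℚ) < (1 / 2) ^ (len i + 1) := by positivity
  obtain ⟨w, hw, hlow, hup⟩ := exists_binaryFraction_lt_le
    (x := ((allocated len enum t + (1 / 2) ^ (len i + 1) : ℚ) : ℝ))
    (by exact_mod_cast (by linarith)) (by exact_mod_cast (by linarith)) (len i + 1)
  norm_cast at hlow
  replace hup : allocated len enum t + (1 / 2) ^ (len i + 1) ≤
      binaryFraction w + (1 / 2) ^ (len i + 1) :=
    (Rat.cast_le (K := ℝ)).1 (by push_cast at hup ⊢; exact hup)
  obtain ⟨q, hq, hql⟩ := hc w t (out i) (requestMachine_eq_some.2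
    ⟨i, ht, hw, by linarith, by rw [hw, hsucc]; linarith, rfl⟩)
  exact ⟨q, hq, by omega⟩

theorem IsRequestSet.exists_half_pow_le (h : IsRequestSet R len out) (hm : IsAPriori m) :
    ∃ c : ℕ, ∀ i, R i → (1 / 2) ^ len i ≤ 2 ^ c * m (out i) := by
  obtain ⟨enum, henum⟩ := exists_isEnumeration h.rePred
  have := h.computable_len
  have := h.computable_out
  have hmass (x : ℕ) (i : ι) : 0 ≤ if out i = x then (1 / 2 : ℚ) ^ len i else 0 := by positivity
  obtain ⟨c, hc⟩ := hm.exists_le_mul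
    (q := fun x k => ∑ i ∈ henum.listed k, if out i = x then (1 / 2 : ℚ) ^ len i else 0)
    (henum.ratComputable_sum_listed (by fun_prop) (by fun_prop))
    (fun x k l hkl => Finset.sum_le_sum_of_subset_of_nonneg (henum.listed_mono hkl)
      fun i _ _ => hmass x i)
    (fun x k => Finset.sum_nonneg fun i _ => hmass x i)
    (fun N k => by
      rw [Finset.sum_comm]
      refine (Finset.sum_le_sum fun i _ => ?_).trans (h.kraft _ fun i => henum.of_mem_listed)
      rw [Finset.sum_ite_eq]
      split_ifs <;> simp)
  refine ⟨c, fun i hi => ?_⟩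
  obtain ⟨t, ht⟩ := (henum.mem_iff i).1 hi
  refine le_trans ?_ (hc (out i) (t + 1))
  have hle := Finset.single_le_sum (fun j _ => hmass (out i) j)
    (henum.mem_listed.2 ⟨t, t.lt_succ_self, ht⟩)
  rw [if_pos rfl] at hle
  simpa only [Rat.cast_pow, Rat.cast_div, Rat.cast_one, Rat.cast_ofNat] using
    (Rat.cast_le (K := ℝ)).2 hle

theorem IsOptimalPrefix.isRequestSet (hP : IsOptimalPrefix P) :
    IsRequestSet (fun x : List Bool × ℕ => x.2 ∈ P x.1) (fun x => x.1.length) fun x => x.2 where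
  rePred := rePred_mem hP.1
  computable_len := by fun_prop
  computable_out := by fun_prop
  kraft S hS := by
    classical
    have hinj : Set.InjOn Prod.fst (S : Set (List Bool × ℕ)) := fun x hx y hy hxy =>
      Prod.ext hxy (Part.mem_unique (hS x hx) (hxy ▸ hS y hy))
    rw [← Finset.sum_image (f := fun p : List Bool => (1 / 2 : ℚ) ^ p.length) hinj]
    refine sum_half_pow_length_le_one fun p hp q hq hpq => ?_
    obtain ⟨x, hx, rfl⟩ := Finset.mem_image.1 hp
    obtain ⟨y, hy, rfl⟩ := Finset.mem_image.1 hq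
    exact hP.2.1 _ _ (Part.dom_iff_mem.2 ⟨_, hS x hx⟩) (Part.dom_iff_mem.2 ⟨_, hS y hy⟩) hpq

theorem exists_busyBeaver_le_tailModulus (hP : IsOptimalPrefix P) (hm : IsAPriori m) :
    ∃ c : ℕ, ∀ t : ℤ, busyBeaver P t ≤ tailModulus m (t + c) := by
  obtain ⟨c, hc⟩ := hP.isRequestSet.exists_half_pow_le hm
  refine ⟨c, fun t => busyBeaver_le fun N p hN hp => ?_⟩
  rcases N with _ | N
  · exact Nat.zero_le _
  refine lt_tailModulus hm.1.1 hm.1.2.1 ?_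
  calc (2 : ℝ) ^ (-(t + c)) = 2 ^ (-t) / 2 ^ c := by
        rw [neg_add, zpow_add₀ two_ne_zero, zpow_neg _ (c : ℤ), zpow_natCast]; rfl
    _ ≤ (1 / 2) ^ p.length / 2 ^ c := by
        rw [one_div, inv_pow, ← zpow_natCast 2 p.length, ← zpow_neg]
        gcongr
        exact one_le_two
    _ ≤ m (N + 1) := by
        rw [div_le_iff₀' (by positivity)]
        exact hc (p, N + 1) hN
    _ ≤ ∑' k, m (N + 1 + k) := (summable_tail hm.1.2.1 (N + 1)).le_tsum 0 fun k _ => hm.1.1 _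

end Requests

section Thresholds

variable {D : List Bool →. ℕ} {m : ℕ → ℝ}

theorem exists_computable_approximation (h0 : ∀ k, 0 ≤ m k) (hsum : Summable m)
    (hm : LowerSemicomputable m) : ∃ A : ℕ → ℚ, RatComputable A ∧
      (∀ s, (A s : ℝ) ≤ ∑ k ∈ Finset.range (s + 1), m k) ∧ ∀ x < ∑' k, m k, ∃ s, x < A s := by
  obtain ⟨q, hq, hmono, hlim⟩ := hm
  rw [computableRat_iff] at hq
  refine ⟨fun s => ∑ k ∈ Finset.range s.unpair.1, q k s.unpair.2, by fun_prop, fun s => ?_,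
    fun x hx => ?_⟩
  · have hqm : ∀ k, (q k s.unpair.2 : ℝ) ≤ m k := fun k =>
      Monotone.ge_of_tendsto (f := fun j => (q k j : ℝ)) (fun _ _ h => Rat.cast_le.2 (hmono k h))
        (hlim k) _
    push_cast
    refine (Finset.sum_le_sum fun k _ => hqm k).trans ?_
    exact Finset.sum_le_sum_of_subset_of_nonneg
      (Finset.range_subset_range.2 (s.unpair_left_le.trans s.le_succ)) fun k _ _ => h0 k
  · obtain ⟨K, hK⟩ := (hsum.hasSum.tendsto_sum_nat.eventually (lt_mem_nhds hx)).exists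
    have hlimK : Tendsto (fun j => ∑ k ∈ Finset.range K, (q k j : ℝ)) atTop
        (𝓝 (∑ k ∈ Finset.range K, m k)) := tendsto_finsetSum _ fun k _ => hlim k
    obtain ⟨j, hj⟩ := (hlimK.eventually (lt_mem_nhds hK)).exists
    exact ⟨Nat.pair K j, by simpa [Nat.unpair_pair] using hj⟩

theorem IsAPriori.tsum_pos (hm : IsAPriori m) : 0 < ∑' k, m k := by
  obtain ⟨c, hc⟩ := hm.exists_le_mul (q := fun x _ => if x = 0 then 1 else 0) (by fun_prop)
    (fun x => monotone_const) (fun x _ => by positivity)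
    fun N _ => by rw [Finset.sum_ite_eq']; split_ifs <;> norm_num
  refine hm.1.2.1.tsum_pos hm.1.1 0 (pos_of_mul_pos_right (zero_lt_one.trans_le ?_)
    (by positivity : (0 : ℝ) ≤ 2 ^ c))
  simpa using hc 0 0

theorem IsOptimalPlain.exists_lt_busyBeaver (hD : IsOptimalPlain D)
    {p : ℕ → List Bool → ℕ → Prop} [∀ i v s, Decidable (p i v s)]
    (hp : IsComputable fun x : ℕ × List Bool × ℕ => decide (p x.1 x.2.1 x.2.2)) :
    ∃ c : ℕ, ∀ i v, (∃ s, p i v s) → ∃ s, p i v s ∧ s < busyBeaver D (v.length + i + c) := by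
  -- The pair `(i, v)` is coded as `0 ^ i 1 v`.
  let F (w : List Bool) (s : ℕ) : Option ℕ :=
    if p (w.idxOf true) (w.drop (w.idxOf true + 1)) s then some (s + 1) else none
  have hF : IsComputable fun x : List Bool × ℕ => F x.1 x.2 := by
    refine .ite (hp.comp (g := fun x : List Bool × ℕ =>
      (x.1.idxOf true, x.1.drop (x.1.idxOf true + 1), x.2)) (by fun_prop)) ?_ ?_ <;> fun_prop
  obtain ⟨c, hc⟩ := hD.exists_program (D' := fun w => Nat.rfindOpt (F w))
    (Partrec.rfindOpt hF.1.to₂)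
  refine ⟨c + 1, fun i v ⟨s₀, hs₀⟩ => ?_⟩
  set w := List.replicate i false ++ true :: v
  have hFw : F w = fun s => if p i v s then some (s + 1) else none := by
    have hi : w.idxOf true = i := by simp [w, List.idxOf_append]
    have hv : w.drop (i + 1) = v := by simp [w, List.drop_append]
    simp only [F, hi, hv]
  obtain ⟨y, hy⟩ := Part.dom_iff_mem.1
    (Nat.rfindOpt_dom (f := F w) |>.2 ⟨s₀, s₀ + 1, by simp [hFw, hs₀]⟩)
  obtain ⟨s, hs⟩ := Nat.rfindOpt_spec hy
  simp only [hFw, Option.mem_def, Option.ite_none_right_eq_some, Option.some.injEq] at hs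
  obtain ⟨hps, rfl⟩ := hs
  obtain ⟨q, hq, hql⟩ := hc _ _ hy
  refine ⟨s, hps, le_busyBeaver hq ?_⟩
  simp only [w, List.length_append, List.length_replicate, List.length_cons] at hql
  omega

theorem exists_tailModulus_lt_busyBeaver_of_threshold (hD : IsOptimalPlain D) (hm : IsAPriori m)
    {θ : ℕ → List Bool → ℚ} (hθ : RatComputable fun x : ℕ × List Bool => θ x.1 x.2) :
    ∃ c : ℕ, ∀ i v (b : ℤ), (θ i v : ℝ) < ∑' k, m k → ∑' k, m k ≤ θ i v + (2 : ℝ) ^ (-b) →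
      tailModulus m b < busyBeaver D (v.length + i + c) := by
  obtain ⟨A, hA, hAm, hAlim⟩ := exists_computable_approximation hm.1.1 hm.1.2.1 hm.1.2.2
  obtain ⟨c, hc⟩ := hD.exists_lt_busyBeaver (p := fun i v s => θ i v < A s) <|
    (hθ.comp (f := fun x : ℕ × List Bool × ℕ => (x.1, x.2.1)) (by fun_prop)).decide_lt
      (hA.comp (by fun_prop))
  refine ⟨c, fun i v b hlow hup => ?_⟩
  obtain ⟨s₀, hs₀⟩ := hAlim _ hlow
  obtain ⟨s, hs, hsB⟩ := hc i v ⟨s₀, Rat.cast_lt.1 hs₀⟩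
  refine (tailModulus_le ?_).trans_lt hsB
  have hs' : (θ i v : ℝ) < A s := Rat.cast_lt.2 hs
  linarith [hAm s, sum_range_add_tail hm.1.2.1 (s + 1)]

theorem exists_tailModulus_le_busyBeaver (hD : IsOptimalPlain D) (hm : IsAPriori m) :
    ∃ c : ℕ, ∀ t : ℤ, tailModulus m t ≤ busyBeaver D (t.toNat + c) := by
  obtain ⟨e, he⟩ := pow_unbounded_of_one_lt (∑' k, m k) (one_lt_two (α := ℝ))
  obtain ⟨c, hc⟩ := exists_tailModulus_lt_busyBeaver_of_threshold hD hm
    (θ := fun _ w => 2 ^ e * binaryFraction w) (by fun_prop)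
  refine ⟨e + c, fun t => ?_⟩
  obtain ⟨w, hw, hlow, hup⟩ := exists_binaryFraction_lt_le (x := (∑' k, m k) / 2 ^ e)
    (div_pos hm.tsum_pos (by positivity)) ((div_le_one (by positivity)).2 he.le) (t.toNat + e)
  rw [lt_div_iff₀' (by positivity)] at hlow
  rw [div_le_iff₀' (by positivity)] at hup
  have hscale : (2 : ℝ) ^ e * (1 / 2) ^ (t.toNat + e) = 2 ^ (-(t.toNat : ℤ)) := by
    rw [zpow_neg, zpow_natCast, pow_add, one_div, inv_pow, inv_pow]
    field_simp
  refine (tailModulus_mono m t.self_le_toNat).trans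
    ((hc 0 w t.toNat ?_ ?_).le.trans (busyBeaver_mono ?_))
  · exact_mod_cast hlow
  · push_cast
    rwa [← hscale, ← mul_add]
  · rw [hw]
    push_cast
    omega

/-- For `γ : ℕ → ℕ`, the strings of length `e` cut an interval of length `2 ^ (e - γ e)`, placed
after those for smaller `e`, into parts of length `2 ^ (-γ e)`; this is the left end of the part
with the given label. -/
def seriesThreshold (γ : ℕ → ℕ) (v : List Bool) : ℚ :=
  ∑ e ∈ Finset.range v.length, 2 ^ e * (1 / 2) ^ γ e +
    2 ^ v.length * (1 / 2) ^ γ v.length * binaryFraction v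

theorem exists_seriesThreshold_lt_le (γ : ℕ → ℕ) {x : ℝ} (hx : 0 < x) {t : ℕ}
    (ht : x ≤ ∑ e ∈ Finset.range t, 2 ^ e * (1 / 2) ^ γ e) :
    ∃ v, (seriesThreshold γ v : ℝ) < x ∧ x ≤ seriesThreshold γ v + (1 / 2) ^ γ v.length := by
  induction t with
  | zero => exact absurd ht (by simpa using hx)
  | succ e ih =>
    rcases le_or_gt x (∑ e' ∈ Finset.range e, 2 ^ e' * (1 / 2) ^ γ e') with hle | hlt
    · exact ih hle
    have hpos : (0 : ℝ) < 2 ^ e * (1 / 2) ^ γ e := by positivity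
    rw [Finset.sum_range_succ, ← sub_le_iff_le_add'] at ht
    obtain ⟨v, rfl, hlow, hup⟩ := exists_binaryFraction_lt_le
      (div_pos (sub_pos.2 hlt) hpos) ((div_le_one hpos).2 ht) e
    have hcancel : (2 : ℝ) ^ v.length * (1 / 2) ^ γ v.length * (1 / 2) ^ v.length =
        (1 / 2) ^ γ v.length := by
      rw [mul_right_comm, ← mul_pow]
      norm_num
    rw [lt_div_iff₀' hpos] at hlow
    rw [div_le_iff₀' hpos, mul_add, hcancel] at hup
    refine ⟨v, ?_, ?_⟩ <;> (unfold seriesThreshold; push_cast; linarith)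

theorem exists_tailModulus_lt_busyBeaver_of_diverging (hD : IsOptimalPlain D) (hm : IsAPriori m)
    {γ : ℕ → ℕ → ℕ} (hγ : IsComputable fun x : ℕ × ℕ => γ x.1 x.2)
    (hdiv : ∀ i : ℕ, ∃ t, (i : ℚ) < ∑ e ∈ Finset.range t, 2 ^ e * (1 / 2) ^ γ i e) :
    ∃ i e : ℕ, tailModulus m (γ i e) < busyBeaver D (e + 2 * i : ℕ) := by
  obtain ⟨c, hc⟩ := exists_tailModulus_lt_busyBeaver_of_threshold hD hm
    (θ := fun i => seriesThreshold (γ i)) (by unfold seriesThreshold; fun_prop)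
  -- The strategy whose index exceeds the constant `c` compensates for it.
  obtain ⟨i, hi⟩ := exists_nat_ge (max (∑' k, m k) c)
  rw [max_le_iff, Nat.cast_le] at hi
  obtain ⟨t, ht⟩ := hdiv i
  have ht' := (Rat.cast_le (K := ℝ)).2 ht.le
  push_cast at ht'
  obtain ⟨v, hlow, hup⟩ := exists_seriesThreshold_lt_le (γ i) hm.tsum_pos (hi.1.trans ht')
  refine ⟨i, v.length, (hc i v _ hlow ?_).trans_le (busyBeaver_mono (by push_cast; omega))⟩
  rwa [zpow_neg, zpow_natCast, ← inv_pow, ← one_div]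

end Thresholds

section Counting

variable {ι : Type*} {S : Finset ι} {len : ι → ℕ} {γ : ℕ → ℕ} {t : ℕ}

theorem sum_two_pow_le {E : Finset ℕ} {x : ℚ} (hx : 0 ≤ x) (h : ∀ e ∈ E, 2 ^ e ≤ x) :
    ∑ e ∈ E, (2 : ℚ) ^ e ≤ 2 * x := by
  rcases E.eq_empty_or_nonempty with rfl | hE
  · simpa using hx
  · have hlt : ∑ e ∈ E, 2 ^ e < 2 ^ (E.max' hE + 1) :=
      Nat.geomSum_lt le_rfl fun k hk => Nat.lt_succ_of_le (E.le_max' k hk)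
    calc ∑ e ∈ E, (2 : ℚ) ^ e ≤ 2 ^ (E.max' hE + 1) := by exact_mod_cast hlt.le
      _ = 2 * 2 ^ E.max' hE := pow_succ' _ _
      _ ≤ 2 * x := by gcongr; exact h _ (E.max'_mem hE)

theorem sum_Ico_half_pow_le (l n : ℕ) : ∑ b ∈ Finset.Ico l n, (1 / 2 : ℚ) ^ b ≤ 2 * (1 / 2) ^ l :=
  (geom_sum_Ico_le_of_lt_one (by norm_num) (by norm_num)).trans_eq (by ring)

theorem sum_card_mul_half_pow_le (hS : ∑ i ∈ S, (1 / 2 : ℚ) ^ len i ≤ 1) (n : ℕ) :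
    ∑ b ∈ Finset.range n, ((S.filter (len · ≤ b)).card : ℚ) * (1 / 2) ^ b ≤ 2 :=
  calc ∑ b ∈ Finset.range n, ((S.filter (len · ≤ b)).card : ℚ) * (1 / 2) ^ b
      = ∑ i ∈ S, ∑ b ∈ Finset.Ico (len i) n, (1 / 2 : ℚ) ^ b := by
        simp only [← nsmul_eq_mul, ← Finset.sum_const]
        refine Finset.sum_comm' fun b i => ?_
        simp only [Finset.mem_range, Finset.mem_filter, Finset.mem_Ico]
        tauto
    _ ≤ ∑ i ∈ S, 2 * (1 / 2) ^ len i := Finset.sum_le_sum fun i _ => sum_Ico_half_pow_le _ _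
    _ ≤ 2 := by rw [← Finset.mul_sum]; linarith

theorem sum_le_of_two_pow_le_card (hS : ∑ i ∈ S, (1 / 2 : ℚ) ^ len i ≤ 1)
    (h : ∀ e < t, (2 : ℚ) ^ e ≤ (S.filter (len · ≤ γ e)).card + 1) :
    ∑ e ∈ Finset.range t, (2 : ℚ) ^ e * (1 / 2) ^ γ e ≤ 8 := by
  obtain ⟨n, hn⟩ : ∃ n, ∀ e < t, γ e < n := ⟨(Finset.range t).sup γ + 1, fun e he =>
    Nat.lt_succ_of_le (Finset.le_sup (Finset.mem_range.2 he))⟩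
  have hlevel (b : ℕ) : ∑ e ∈ (Finset.range t).filter (γ · ≤ b), (2 : ℚ) ^ e ≤
      2 * ((S.filter (len · ≤ b)).card + 1) := by
    refine sum_two_pow_le (by positivity) fun e he => ?_
    rw [Finset.mem_filter, Finset.mem_range] at he
    refine (h e he.1).trans ?_
    gcongr
    exact he.2
  calc ∑ e ∈ Finset.range t, (2 : ℚ) ^ e * (1 / 2) ^ γ e
      ≤ ∑ e ∈ Finset.range t, ∑ b ∈ Finset.Ico (γ e) n, 2 ^ e * (1 / 2 : ℚ) ^ b := by
        refine Finset.sum_le_sum fun e he => Finset.single_le_sum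
          (f := fun b => 2 ^ e * (1 / 2 : ℚ) ^ b) (fun b _ => by positivity) ?_
        exact Finset.left_mem_Ico.2 (hn e (Finset.mem_range.1 he))
    _ = ∑ b ∈ Finset.range n, (∑ e ∈ (Finset.range t).filter (γ · ≤ b), 2 ^ e) * (1 / 2) ^ b := by
        simp only [Finset.sum_mul]
        refine Finset.sum_comm' fun e b => ?_
        simp only [Finset.mem_range, Finset.mem_filter, Finset.mem_Ico]
        tauto
    _ ≤ ∑ b ∈ Finset.range n, 2 * ((S.filter (len · ≤ b)).card + 1) * (1 / 2 : ℚ) ^ b := by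
        gcongr with b
        exact hlevel b
    _ = 2 * ∑ b ∈ Finset.range n, ((S.filter (len · ≤ b)).card : ℚ) * (1 / 2) ^ b +
          2 * ∑ b ∈ Finset.Ico 0 n, (1 / 2) ^ b := by
        rw [← Finset.range_eq_Ico, Finset.mul_sum, Finset.mul_sum, ← Finset.sum_add_distrib]
        exact Finset.sum_congr rfl fun b _ => by ring
    _ ≤ 8 := by linarith [sum_card_mul_half_pow_le hS n, sum_Ico_half_pow_le 0 n]

end Counting

section Coverage

variable {ι : Type*} [Primcodable ι] {R : ι → Prop} {enum : ℕ → Option ι} {len : ι → ℕ}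
  {γ : ℕ → ℕ} {s t : ℕ}

namespace IsEnumeration

theorem exists_forall_mem_listed (h : IsEnumeration R enum) {F : Set ι} (hF : F.Finite)
    (hR : ∀ i ∈ F, R i) : ∃ N, ∀ i ∈ F, i ∈ h.listed N := by
  have hev : ∀ᶠ N in atTop, ∀ i ∈ F, i ∈ h.listed N :=
    (eventually_all_finite hF).2 fun i hi => by
      obtain ⟨t, ht⟩ := (h.mem_iff i).1 (hR i hi)
      filter_upwards [eventually_gt_atTop t] with N hN
      exact h.mem_listed.2 ⟨t, hN, ht⟩
  exact hev.exists

/-- How far the stage `s` of an enumeration is in producing, for every `e < t`, as many as `2 ^ e`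
elements of length at most `γ e`. One element is credited in advance at every positive stage, so
that progress remains to be made as long as some such element is missing. -/
def coverage (h : IsEnumeration R enum) (len : ι → ℕ) (γ : ℕ → ℕ) (t s : ℕ) : ℚ :=
  (Finset.range t).fold min 1 fun e =>
    (1 / 2) ^ e * (((h.listed s).filter (len · ≤ γ e)).card + if 0 < s then 1 else 0)

variable (h : IsEnumeration R enum)

theorem coverage_le_one : h.coverage len γ t s ≤ 1 :=
  (Finset.le_fold_min _).1 le_rfl |>.1

theorem coverage_le {e : ℕ} (he : e < t) : h.coverage len γ t s ≤
    (1 / 2) ^ e * (((h.listed s).filter (len · ≤ γ e)).card + if 0 < s then 1 else 0) :=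
  ((Finset.le_fold_min _).1 le_rfl).2 e (Finset.mem_range.2 he)

theorem coverage_nonneg : 0 ≤ h.coverage len γ t s :=
  (Finset.le_fold_min _).2 ⟨zero_le_one, fun e _ => by positivity⟩

theorem coverage_mono : Monotone (h.coverage len γ t) := fun s s' hs =>
  (Finset.le_fold_min _).2 ⟨h.coverage_le_one, fun e he =>
    (h.coverage_le (Finset.mem_range.1 he)).trans <| by
      have hcredit : (if 0 < s then 1 else 0 : ℚ) ≤ if 0 < s' then 1 else 0 := by
        split_ifs <;> first | omega | norm_num
      gcongr
      exact h.listed_mono hs⟩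

theorem ratComputable_coverage {α : Type*} [Primcodable α] (hlen : IsComputable len)
    {γ : α → ℕ → ℕ} {t s : α → ℕ} (hγ : IsComputable fun x : α × ℕ => γ x.1 x.2)
    (ht : IsComputable t) (hs : IsComputable s) :
    RatComputable fun a => h.coverage len (γ a) (t a) (s a) := by
  simp only [coverage, Finset.card_filter, Nat.cast_sum, Nat.cast_ite, Nat.cast_one, Nat.cast_zero]
  fun_prop

theorem exists_half_pow_le_coverage_sub (hs : 0 < s)
    (hkraft : ∑ i ∈ h.listed s, (1 / 2 : ℚ) ^ len i ≤ 1)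
    (hγ : 8 < ∑ e ∈ Finset.range t, (2 : ℚ) ^ e * (1 / 2) ^ γ e) :
    ∃ e < t, ∀ x, (x = 0 ∨ ∃ i ∈ h.listed s, len i ≤ γ e ∧ i ∉ h.listed x) → x ≤ s →
      (1 / 2) ^ e ≤ h.coverage len γ t s - h.coverage len γ t x := by
  rcases (Finset.fold_min_le _).1 (le_refl (h.coverage len γ t s)) with hfull | ⟨e, he, hcov⟩
  · refine absurd (sum_le_of_two_pow_le_card hkraft fun e he => ?_) hγ.not_ge
    have hle := hfull.trans (h.coverage_le he)
    rwa [if_pos hs, one_div, inv_pow, le_inv_mul_iff₀ (by positivity), mul_one] at hle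
  refine ⟨e, Finset.mem_range.1 he, fun x hx hxs => ?_⟩
  rw [if_pos hs] at hcov
  have hgain : (((h.listed x).filter (len · ≤ γ e)).card + if 0 < x then 1 else 0 : ℚ) ≤
      ((h.listed s).filter (len · ≤ γ e)).card := by
    rcases hx with rfl | ⟨i, his, hlen, hix⟩
    · simp [listed]
    · have hlt : ((h.listed x).filter (len · ≤ γ e)).card <
          ((h.listed s).filter (len · ≤ γ e)).card := by
        refine Finset.card_lt_card (Finset.ssubset_iff_of_subset
          (Finset.filter_subset_filter _ (h.listed_mono hxs)) |>.2 ⟨i, ?_, ?_⟩)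
        · exact Finset.mem_filter.2 ⟨his, hlen⟩
        · exact fun hi => hix (Finset.mem_filter.1 hi).1
      have : (if 0 < x then 1 else 0 : ℚ) ≤ 1 := by split_ifs <;> norm_num
      have : (((h.listed x).filter (len · ≤ γ e)).card + 1 : ℚ) ≤
        ((h.listed s).filter (len · ≤ γ e)).card := by exact_mod_cast hlt
      linarith
  have := (h.coverage_le (s := x) (Finset.mem_range.1 he)).trans
    (mul_le_mul_of_nonneg_left hgain (by positivity))
  linarith

end IsEnumeration

end Coverage

section Escape

variable {P : List Bool →. ℕ} {m : ℕ → ℝ}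

theorem sum_range_sub_pred (φ : ℕ → ℚ) (n : ℕ) :
    ∑ x ∈ Finset.range n, (φ x - φ (x - 1)) = φ (n - 1) - φ 0 := by
  rcases n with _ | n
  · simp
  · simp only [Finset.sum_range_succ', Nat.add_sub_cancel, Nat.zero_sub, sub_self, add_zero,
      Finset.sum_range_sub]

theorem sum_half_pow_succ_le_one (n : ℕ) : ∑ i ∈ Finset.range n, (1 / 2 : ℚ) ^ (i + 1) ≤ 1 := by
  simp only [pow_succ]
  rw [← Finset.sum_mul, Finset.range_eq_Ico]
  linarith [sum_Ico_half_pow_le 0 n]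

theorem IsAPriori.exists_sub_le (hm : IsAPriori m) {φ : ℕ → ℕ → ℚ}
    (hφ : RatComputable fun x : ℕ × ℕ => φ x.1 x.2) (hmono : ∀ i, Monotone (φ i))
    (h0 : ∀ i s, 0 ≤ φ i s) (h1 : ∀ i s, φ i s ≤ 1) :
    ∃ i : ℕ, ∀ x s, x ≤ s → (φ i s - φ i x : ℝ) ≤ 2 ^ (2 * i + 1) * ∑' k, m (x + 1 + k) := by
  -- The potentials are summed with weights `2 ^ (-(i + 1))`; for the one whose index `i` is the
  -- domination constant, the total loss `2 ^ (2 * i + 1)` is known in advance.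
  have hstep (x i : ℕ) : 0 ≤ (1 / 2 : ℚ) ^ (i + 1) * (φ i x - φ i (x - 1)) :=
    mul_nonneg (by positivity) (sub_nonneg.2 (hmono i x.pred_le))
  obtain ⟨i, hi⟩ := hm.exists_le_mul
    (q := fun x k => ∑ i ∈ Finset.range k, (1 / 2) ^ (i + 1) * (φ i x - φ i (x - 1)))
    (by fun_prop)
    (fun x j k hjk => Finset.sum_le_sum_of_subset_of_nonneg (Finset.range_mono hjk)
      fun i _ _ => hstep x i)
    (fun x k => Finset.sum_nonneg fun i _ => hstep x i)
    (fun N k => by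
      rw [Finset.sum_comm]
      refine (Finset.sum_le_sum fun i _ => ?_).trans (sum_half_pow_succ_le_one k)
      rw [← Finset.mul_sum, sum_range_sub_pred]
      exact mul_le_of_le_one_right (by positivity) (by linarith [h1 i (N - 1), h0 i 0]))
  refine ⟨i, fun x s hxs => ?_⟩
  obtain ⟨d, rfl⟩ := Nat.exists_eq_add_of_le hxs
  have hinc (y : ℕ) : (φ i y - φ i (y - 1) : ℝ) ≤ 2 ^ (2 * i + 1) * m y := by
    have hle := (Rat.cast_le (K := ℝ).2 (Finset.single_le_sum (fun i _ => hstep y i)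
      (Finset.self_mem_range_succ i))).trans (hi y (i + 1))
    push_cast at hle
    rw [one_div, inv_pow, inv_mul_le_iff₀ (by positivity)] at hle
    exact hle.trans_eq (by ring)
  calc (φ i (x + d) - φ i x : ℝ)
      = ∑ k ∈ Finset.range d, ((φ i (x + 1 + k) : ℝ) - φ i (x + 1 + k - 1)) := by
        simp only [add_right_comm x 1, Nat.add_sub_cancel]
        exact (Finset.sum_range_sub (fun k => (φ i (x + k) : ℝ)) d).symm
    _ ≤ ∑ k ∈ Finset.range d, 2 ^ (2 * i + 1) * m (x + 1 + k) :=
        Finset.sum_le_sum fun k _ => hinc _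
    _ ≤ 2 ^ (2 * i + 1) * ∑' k, m (x + 1 + k) := by
        rw [← Finset.mul_sum]
        gcongr
        exact (summable_tail hm.1.2.1 (x + 1)).sum_le_tsum _ fun k _ => hm.1.1 _

theorem finite_setOf_program (P : List Bool →. ℕ) (b : ℕ) :
    {x : List Bool × ℕ | x.2 ∈ P x.1 ∧ x.1.length ≤ b}.Finite :=
  .of_injOn (f := Prod.fst) (t := {p : List Bool | p.length ≤ b}) (fun _ hx => hx.2)
    (fun _ hx _ hy hxy => Prod.ext hxy (Part.mem_unique hx.1 (hxy ▸ hy.1)))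
    (List.finite_length_le Bool b)

theorem IsEnumeration.exists_stage_busyBeaver {enum : ℕ → Option (List Bool × ℕ)}
    (h : IsEnumeration (fun x : List Bool × ℕ => x.2 ∈ P x.1) enum) (b : ℕ) :
    ∃ s > 0, ∀ l ≤ b, busyBeaver P l ≤ s ∧ (busyBeaver P l = 0 ∨
      ∃ x ∈ h.listed s, x.1.length ≤ l ∧ x ∉ h.listed (busyBeaver P l)) := by
  obtain ⟨N, hN⟩ := h.exists_forall_mem_listed (finite_setOf_program P b) fun x hx => hx.1
  refine ⟨N + busyBeaver P b + 1, Nat.succ_pos _, fun l hl => ⟨?_, ?_⟩⟩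
  · have := busyBeaver_mono (D := P) (Int.ofNat_le.2 hl)
    omega
  refine (busyBeaver_mem_or_eq_zero P l).symm.imp_right fun ⟨p, hp, hpl⟩ => ?_
  rw [Nat.cast_le] at hpl
  refine ⟨(p, _), h.listed_mono (by omega) (hN _ ⟨hp, hpl.trans hl⟩), hpl, fun hlisted => ?_⟩
  obtain ⟨k, hk, hkp⟩ := h.mem_listed.1 hlisted
  exact hk.not_ge ((Nat.right_le_pair _ _).trans (h.encode_le hkp))

theorem exists_busyBeaver_lt_tailModulus_of_diverging (hP : IsOptimalPrefix P) (hm : IsAPriori m)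
    {γ : ℕ → ℕ → ℕ} (hγ : IsComputable fun x : ℕ × ℕ => γ x.1 x.2)
    (hdiv : ∀ i : ℕ, ∃ t, (8 : ℚ) < ∑ e ∈ Finset.range t, 2 ^ e * (1 / 2) ^ γ i e) :
    ∃ i e : ℕ, busyBeaver P (γ i e) < tailModulus m (e + 2 * i + 1 : ℕ) := by
  have hprograms := hP.isRequestSet
  obtain ⟨enum, henum⟩ := exists_isEnumeration hprograms.rePred
  obtain ⟨t, ht, hdiv⟩ : ∃ t : ℕ → ℕ, IsComputable t ∧
      ∀ i, (8 : ℚ) < ∑ e ∈ Finset.range (t i), 2 ^ e * (1 / 2) ^ γ i e :=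
    ⟨fun i => Nat.find (hdiv i), .find (RatComputable.decide_lt (by fun_prop) (by fun_prop)) hdiv,
      fun i => Nat.find_spec (hdiv i)⟩
  obtain ⟨i, hi⟩ := hm.exists_sub_le
    (φ := fun i s => henum.coverage (fun x => x.1.length) (γ i) (t i) s)
    (henum.ratComputable_coverage (by fun_prop) (by fun_prop) (by fun_prop) (by fun_prop))
    (fun i => henum.coverage_mono) (fun i s => henum.coverage_nonneg)
    fun i s => henum.coverage_le_one
  obtain ⟨s, hs, hstage⟩ := henum.exists_stage_busyBeaver ((Finset.range (t i)).sup (γ i))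
  obtain ⟨e, he, hcov⟩ := henum.exists_half_pow_le_coverage_sub hs
    (hprograms.kraft _ fun x => henum.of_mem_listed) (hdiv i)
  obtain ⟨hxs, hx⟩ := hstage (γ i e) (Finset.le_sup (Finset.mem_range.2 he))
  have hle := (Rat.cast_le (K := ℝ)).2 (hcov _ hx hxs)
  push_cast at hle
  refine ⟨i, e, lt_tailModulus hm.1.1 hm.1.2.1 ?_⟩
  rw [zpow_neg, zpow_natCast, add_assoc, pow_add, mul_inv, ← inv_pow 2 e, ← one_div (2 : ℝ),
    mul_comm, inv_mul_le_iff₀ (by positivity)]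
  exact hle.trans (hi _ _ hxs)

end Escape

section Convergence

variable {D P : List Bool →. ℕ} {m : ℕ → ℝ} {a : ℕ → ℤ} {X Y : ℤ → ℕ}

theorem exists_computable_approximation_isLeast {R : ℕ → ℕ → Prop} {b : ℕ → ℕ}
    (hR : REPred fun x : ℕ × ℕ => R x.1 x.2) (hb : ∀ e, IsLeast {n | R e n} (b e)) :
    ∃ β : ℕ → ℕ → ℕ, (IsComputable fun x : ℕ × ℕ => β x.1 x.2) ∧ (∀ e k, R e (β e k)) ∧
      ∀ e, ∀ᶠ k in atTop, β e k = b e := by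
  obtain ⟨found, hfound, hmono, -, hfoundR⟩ := exists_computable_stages hR
  have hmono' {e n j k} (hjk : j ≤ k) : found (e, n) j → found (e, n) k :=
    Bool.le_iff_imp.1 (hmono (e, n) hjk)
  have hfirst (e) : ∃ x : ℕ, found (e, x.unpair.1) x.unpair.2 := by
    obtain ⟨k, hk⟩ := (hfoundR (e, b e)).1 (hb e).1
    exact ⟨Nat.pair (b e) k, by simpa only [Nat.unpair_pair] using hk⟩
  let start (e : ℕ) : ℕ := (Nat.find (hfirst e)).unpair.2
  have hstart : IsComputable start := .snd (.unpair (.find (by fun_prop) hfirst))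
  have hex (x : ℕ × ℕ) : ∃ n, found (x.1, n) (x.2 + start x.1) :=
    ⟨_, hmono' (Nat.le_add_left _ _) (Nat.find_spec (hfirst x.1))⟩
  have hβ (e k) : R e (Nat.find (hex (e, k))) :=
    (hfoundR (e, _)).2 ⟨_, Nat.find_spec (hex (e, k))⟩
  refine ⟨fun e k => Nat.find (hex (e, k)), .find (by fun_prop) hex, hβ, fun e => ?_⟩
  obtain ⟨k₀, hk₀⟩ := (hfoundR (e, b e)).1 (hb e).1
  filter_upwards [eventually_ge_atTop k₀] with k hk
  exact (Nat.find_min' _ (hmono' (hk.trans (Nat.le_add_right _ _)) hk₀)).antisymm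
    ((hb e).2 (hβ e k))

theorem exists_lt_sum_of_not_summable {b : ℕ → ℕ}
    (hb : ¬ Summable fun e => (2 : ℝ) ^ e * (1 / 2) ^ b e) (i c : ℕ) (M : ℚ) :
    ∃ t, M < ∑ e ∈ Finset.range t, 2 ^ e * (1 / 2) ^ (b (e + i) + c) := by
  have hshift : ¬ Summable fun e => (2 : ℝ) ^ e * (1 / 2) ^ (b (e + i) + c) := fun h => by
    refine hb ((summable_nat_add_iff i).1 ((h.mul_left (2 ^ i * 2 ^ c)).congr fun e => ?_))
    rw [pow_add, pow_add, one_div, inv_pow 2 c]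
    field_simp
  obtain ⟨t, ht⟩ := (((not_summable_iff_tendsto_nat_atTop_of_nonneg
    fun e => by positivity).1 hshift).eventually_gt_atTop (M : ℝ)).exists
  exact ⟨t, (Rat.cast_lt (K := ℝ)).1 (by push_cast; exact ht)⟩

/-- The growth rates `X` and `Y` force convergence if bounds `X e ≤ Y (n + c)` that can be
recursively enumerated, with `b e` the least `n` occurring in a bound for `X e`, are only possible
when `∑ 2 ^ (e - b e)` converges. -/
def ForcesSummable (X Y : ℤ → ℕ) : Prop :=
  ∀ (R : ℕ → ℕ → Prop) (b : ℕ → ℕ) (c : ℕ), REPred (fun x : ℕ × ℕ => R x.1 x.2) →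
    (∀ e n, R e n → X e ≤ Y (n + c)) → (∀ e, IsLeast {n | R e n} (b e)) →
      Summable fun e => (2 : ℝ) ^ e * (1 / 2) ^ b e

theorem forcesSummable_of_diverging
    (h : ∀ γ : ℕ → ℕ → ℕ, (IsComputable fun x : ℕ × ℕ => γ x.1 x.2) →
      (∀ i : ℕ, ∃ t, (i + 8 : ℚ) < ∑ e ∈ Finset.range t, 2 ^ e * (1 / 2) ^ γ i e) →
        ∃ i e : ℕ, Y (γ i e) < X (e + 2 * i + 1 : ℕ)) : ForcesSummable X Y := by
  intro R b c hR hXY hb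
  by_contra hs
  obtain ⟨β, hβ, hRβ, hlim⟩ := exists_computable_approximation_isLeast hR hb
  let sum (i x : ℕ) : ℚ := ∑ e ∈ Finset.range x.unpair.1,
    2 ^ e * (1 / 2) ^ (β (e + (2 * i + 1)) x.unpair.2 + c)
  have hex (i : ℕ) : ∃ x, (i + 8 : ℚ) < sum i x := by
    obtain ⟨t, ht⟩ := exists_lt_sum_of_not_summable hs (2 * i + 1) c (i + 8)
    obtain ⟨k, hk⟩ := ((eventually_all_finset (Finset.range t)).2 fun e _ =>
      hlim (e + (2 * i + 1))).exists
    refine ⟨Nat.pair t k, ht.trans_eq ?_⟩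
    simp only [sum, Nat.unpair_pair]
    exact Finset.sum_congr rfl fun e he => by rw [hk e he]
  obtain ⟨w, hw, hdiv⟩ : ∃ w : ℕ → ℕ, IsComputable w ∧ ∀ i : ℕ, (i + 8 : ℚ) < sum i (w i) :=
    ⟨fun i => Nat.find (hex i), .find (RatComputable.decide_lt (by fun_prop) (by fun_prop)) hex,
      fun i => Nat.find_spec (hex i)⟩
  obtain ⟨i, e, hie⟩ := h (fun i e => β (e + (2 * i + 1)) (w i).unpair.2 + c) (by fun_prop)
    fun i => ⟨_, hdiv i⟩
  exact hie.not_ge (by exact_mod_cast hXY _ _ (hRβ (e + (2 * i + 1)) _))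

theorem forcesSummable_busyBeaver_tailModulus (hD : IsOptimalPlain D) (hm : IsAPriori m) :
    ForcesSummable (busyBeaver D) (tailModulus m) :=
  forcesSummable_of_diverging fun γ hγ hdiv => by
    obtain ⟨i, e, h⟩ := exists_tailModulus_lt_busyBeaver_of_diverging hD hm hγ fun i =>
      (hdiv i).imp fun t ht => by linarith
    exact ⟨i, e, h.trans_le (busyBeaver_mono (by omega))⟩

theorem forcesSummable_tailModulus_busyBeaver (hP : IsOptimalPrefix P) (hm : IsAPriori m) :
    ForcesSummable (tailModulus m) (busyBeaver P) :=
  forcesSummable_of_diverging fun γ hγ hdiv =>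
    exists_busyBeaver_lt_tailModulus_of_diverging hP hm hγ fun i =>
      (hdiv i).imp fun t ht => by linarith [i.cast_nonneg (α := ℚ)]

theorem UpperSemicomputable.rePred_add_le (ha : UpperSemicomputable fun n => (a n : ℝ)) :
    REPred fun x : ℕ × ℕ × ℕ => a x.1 + x.2.1 ≤ x.2.2 := by
  obtain ⟨q, hq, hanti, hlim⟩ := ha
  rw [computableRat_iff] at hq
  have hle (n k) : (a n : ℝ) ≤ q n k := Antitone.le_of_tendsto (f := fun k => (q n k : ℝ))
    (fun _ _ h => Rat.cast_le.2 (hanti n h)) (hlim n) k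
  refine (rePred_exists (p := fun (x : ℕ × ℕ × ℕ) k => q x.1 k < x.2.2 - x.2.1 + 1)
    (RatComputable.decide_lt (hq.comp (f := fun x : (ℕ × ℕ × ℕ) × ℕ => (x.1.1, x.2)) (by fun_prop))
      (by fun_prop))).of_eq fun ⟨n, v, u⟩ => ⟨fun ⟨k, hk⟩ => ?_, fun h => ?_⟩
  · have hlt := (hle n k).trans_lt (Rat.cast_lt.2 hk)
    rw [← Int.lt_add_one_iff]
    push_cast at hlt
    rify
    linarith
  · have hlt : (a n : ℝ) < u - v + 1 := by
      rify at h
      linarith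
    obtain ⟨k, hk⟩ := ((hlim n).eventually (gt_mem_nhds hlt)).exists
    exact ⟨k, by exact_mod_cast hk⟩

theorem summable_of_le_add (hXY : ForcesSummable X Y) (hY : Monotone Y)
    (ha : UpperSemicomputable fun n => (a n : ℝ))
    (h : ∃ c : ℕ, ∀ n : ℕ, X n ≤ Y (n + a n + c)) :
    Summable fun n : ℕ => (2 : ℝ) ^ (-a n) := by
  obtain ⟨c, hc⟩ := h
  have hs := hXY (fun e n => a e + e ≤ n) (fun e => (a e + e).toNat) c
    (rePred_comp (f := fun x : ℕ × ℕ => (x.1, x.1, x.2)) ha.rePred_add_le (by fun_prop))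
    (fun e n hn => (hc e).trans (hY (by omega)))
    (fun e => ⟨Int.self_le_toNat _, fun n hn => Int.toNat_le.2 hn⟩)
  refine hs.of_norm_bounded_eventually_nat ?_
  filter_upwards [hs.tendsto_atTop_zero.eventually (gt_mem_nhds one_pos)] with n hn
  have hpos : 0 < (a n + n).toNat := by
    by_contra! h0
    rw [Nat.le_zero.1 h0, pow_zero, mul_one] at hn
    exact hn.not_ge (one_le_pow₀ one_le_two)
  rw [Real.norm_of_nonneg (by positivity), one_div, inv_pow, ← zpow_natCast, ← zpow_natCast,
    ← zpow_neg, ← zpow_add₀ two_ne_zero]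
  exact zpow_le_zpow_right₀ one_le_two (by omega)

-- All `n` with `g n = e` satisfy `ν e ≤ n`, so their terms amount to at most `2 * 2 ^ (e - ν e)`.
theorem summable_two_pow_mul_half_pow {ν g : ℕ → ℕ} {S : Set ℕ}
    (hν : Summable fun e => (2 : ℝ) ^ e * (1 / 2) ^ ν e) (hS : ∀ n ∈ S, ν (g n) ≤ n) :
    Summable fun n : S => (2 : ℝ) ^ g n * (1 / 2) ^ (n : ℕ) := by
  have hprod : Summable fun x : ℕ × ℕ => (2 : ℝ) ^ x.1 * (1 / 2) ^ ν x.1 * (1 / 2) ^ x.2 :=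
    hν.mul_of_nonneg summable_geometric_two (fun e => by positivity) fun d => by positivity
  have hinj : Function.Injective fun n : S => (g n, (n : ℕ) - ν (g n)) := fun n n' hn => by
    obtain ⟨hg, hd⟩ := Prod.mk.inj hn
    rw [← hg] at hd
    have := hS n n.2
    have := hg ▸ hS n' n'.2
    exact Subtype.ext (by omega)
  refine (hprod.comp_injective hinj).congr fun n => ?_
  simp only [Function.comp_apply]
  rw [mul_assoc, ← pow_add, Nat.add_sub_cancel' (hS n n.2)]

theorem summable_of_sub_le (hXY : ForcesSummable X Y) (hX : Monotone X)
    (ha : UpperSemicomputable fun n => (a n : ℝ))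
    (h : ∃ c : ℕ, ∀ n : ℕ, X (n - a n) ≤ Y (n + c)) :
    Summable fun n : ℕ => (2 : ℝ) ^ (-a n) := by
  obtain ⟨c, hc⟩ := h
  have hhalf (n : ℕ) : (1 / 2 : ℝ) ^ n = 2 ^ (-(n : ℤ)) := by
    rw [one_div, inv_pow, zpow_neg, zpow_natCast]
  by_cases hbdd : ∃ M : ℕ, ∀ n : ℕ, n - a n ≤ M
  · obtain ⟨M, hM⟩ := hbdd
    refine .of_nonneg_of_le (fun n => by positivity) (fun n => ?_)
      (summable_geometric_two.mul_left (2 ^ M))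
    rw [hhalf, ← zpow_natCast, ← zpow_add₀ two_ne_zero]
    exact zpow_le_zpow_right₀ one_le_two (by have := hM n; omega)
  push Not at hbdd
  have hex (e : ℕ) : ∃ n : ℕ, a n + e ≤ n := (hbdd e).imp fun n hn => by omega
  have hν := hXY (fun e n => a n + e ≤ n) (fun e => Nat.find (hex e)) c
    (rePred_comp (f := fun x : ℕ × ℕ => (x.2, x.1, x.2)) ha.rePred_add_le (by fun_prop))
    (fun e n hn => (hX (by omega)).trans (hc n))
    (fun e => ⟨Nat.find_spec (hex e), fun n hn => Nat.find_min' _ hn⟩)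
  refine summable_subtype_and_compl (s := {n : ℕ | a n ≤ n}).1 ⟨?_, ?_⟩
  · refine (summable_two_pow_mul_half_pow (g := fun n => (n - a n).toNat) hν fun n hn =>
      Nat.find_min' _ ?_).congr fun n => ?_
    · have : a n ≤ n := hn
      omega
    · have : a n ≤ n := n.2
      rw [hhalf, ← zpow_natCast, ← zpow_add₀ two_ne_zero]
      congr 1
      omega
  · refine .of_nonneg_of_le (fun n => by positivity) (fun n => ?_)
      (summable_geometric_two.comp_injective Subtype.val_injective)
    have : ¬ a n ≤ n := n.2
    rw [Function.comp_apply, hhalf]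
    exact zpow_le_zpow_right₀ one_le_two (by omega)

end Convergence

section Coding

variable {D P : List Bool →. ℕ} {a : ℕ → ℤ}

theorem sum_le_sum_image_fst {ι κ : Type*} [DecidableEq ι] {S : Finset (ι × κ)}
    {f : ι → ℚ} {g : ι → κ → ℚ}
    (h : ∀ i, ∀ T : Finset κ, (∀ k ∈ T, (i, k) ∈ S) → ∑ k ∈ T, g i k ≤ f i) :
    ∑ x ∈ S, g x.1 x.2 ≤ ∑ i ∈ S.image Prod.fst, f i := by
  classical
  rw [← Finset.sum_fiberwise_of_maps_to fun x => Finset.mem_image_of_mem Prod.fst]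
  refine Finset.sum_le_sum fun i _ => ?_
  have hfst {x : ι × κ} (hx : x ∈ S.filter (·.1 = i)) : x ∈ S ∧ (i, x.2) = x := by
    obtain ⟨hxS, rfl⟩ := Finset.mem_filter.1 hx
    exact ⟨hxS, rfl⟩
  refine le_trans (le_of_eq ?_) (h i ((S.filter (·.1 = i)).image Prod.snd) fun k hk => ?_)
  · rw [Finset.sum_image fun x hx y hy hxy => by
      rw [← (hfst hx).2, ← (hfst hy).2, hxy]]
    exact Finset.sum_congr rfl fun x hx => by rw [(Finset.mem_filter.1 hx).2]
  · obtain ⟨x, hx, rfl⟩ := Finset.mem_image.1 hk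
    rw [(hfst hx).2]
    exact (hfst hx).1

theorem isRequestSet_of_tsum_le_one (ha : UpperSemicomputable fun n => (a n : ℝ))
    (hs : Summable fun n : ℕ => (2 : ℝ) ^ (-a n)) {d : ℕ} (hd : ∑' n, (2 : ℝ) ^ (-a n) ≤ 2 ^ d) :
    IsRequestSet (fun x : ℕ × ℕ => a x.1 + (d + 1 : ℕ) ≤ x.2) Prod.snd Prod.fst where
  rePred := rePred_comp (f := fun x : ℕ × ℕ => (x.1, d + 1, x.2)) ha.rePred_add_le (by fun_prop)
  computable_len := by fun_prop
  computable_out := by fun_prop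
  kraft S hS := by
    refine (sum_le_sum_image_fst (f := fun n => 2 ^ (-a n) / 2 ^ d)
      (g := fun _ k => (1 / 2 : ℚ) ^ k) fun n T hT => ?_).trans ?_
    · obtain ⟨N, hN⟩ := T.exists_nat_subset_range
      have hTIco : T ⊆ Finset.Ico (a n + (d + 1 : ℕ)).toNat N := fun k hk =>
        Finset.mem_Ico.2 ⟨Int.toNat_le.2 (hS _ (hT k hk)), Finset.mem_range.1 (hN hk)⟩
      calc ∑ k ∈ T, (1 / 2 : ℚ) ^ k
          ≤ ∑ k ∈ Finset.Ico (a n + (d + 1 : ℕ)).toNat N, (1 / 2 : ℚ) ^ k :=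
            Finset.sum_le_sum_of_subset_of_nonneg hTIco fun _ _ _ => by positivity
        _ ≤ 2 * (1 / 2) ^ (a n + (d + 1 : ℕ)).toNat := sum_Ico_half_pow_le _ _
        _ = 2 ^ (1 - ((a n + (d + 1 : ℕ)).toNat : ℤ)) := by
            rw [sub_eq_add_neg, zpow_add₀ two_ne_zero, zpow_one, zpow_neg, zpow_natCast, one_div,
              inv_pow]
        _ ≤ 2 ^ (-a n - d) := zpow_le_zpow_right₀ one_le_two (by omega)
        _ = 2 ^ (-a n) / 2 ^ d := by rw [zpow_sub₀ two_ne_zero, zpow_natCast]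
    · rw [← Finset.sum_div, div_le_one (by positivity)]
      refine (Rat.cast_le (K := ℝ)).1 ?_
      push_cast
      exact (hs.sum_le_tsum _ fun n _ => by positivity).trans hd

theorem exists_program_le_of_summable (hP : IsOptimalPrefix P)
    (ha : UpperSemicomputable fun n => (a n : ℝ)) (hs : Summable fun n : ℕ => (2 : ℝ) ^ (-a n)) :
    ∃ c : ℕ, ∀ n, ∃ p, n ∈ P p ∧ (p.length : ℤ) ≤ a n + c := by
  obtain ⟨d, hd⟩ := pow_unbounded_of_one_lt (∑' n, (2 : ℝ) ^ (-a n)) one_lt_two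
  have hpos (n : ℕ) : 0 ≤ a n + d := by
    have hlt : (2 : ℝ) ^ (-a n) < 2 ^ (d : ℤ) := by
      rw [zpow_natCast]
      exact (hs.le_tsum n fun _ _ => by positivity).trans_lt hd
    have := (zpow_lt_zpow_iff_right₀ one_lt_two).1 hlt
    omega
  obtain ⟨c, hc⟩ := (isRequestSet_of_tsum_le_one ha hs hd.le).exists_program hP
  refine ⟨d + 1 + c, fun n => ?_⟩
  obtain ⟨p, hp, hpc⟩ := hc (n, (a n + (d + 1 : ℕ)).toNat) (Int.self_le_toNat _)
  have := hpos n
  exact ⟨p, hp, by omega⟩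

theorem summable_of_program_le (hP : IsOptimalPrefix P)
    (h : ∃ c : ℕ, ∀ n, ∃ p, n ∈ P p ∧ (p.length : ℤ) ≤ a n + c) :
    Summable fun n : ℕ => (2 : ℝ) ^ (-a n) := by
  obtain ⟨c, hc⟩ := h
  choose p hp hpa using hc
  refine summable_of_sum_range_le (c := 2 ^ c) (fun n => by positivity) fun N => ?_
  have hkraft := hP.isRequestSet.kraft ((Finset.range N).image fun n => (p n, n))
    (by simp only [Finset.forall_mem_image]; exact fun n _ => hp n)
  rw [Finset.sum_image fun _ _ _ _ h => (Prod.mk.inj h).2] at hkraft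
  replace hkraft : ∑ n ∈ Finset.range N, (1 / 2 : ℝ) ^ (p n).length ≤ 1 := by
    simpa only [Rat.cast_sum, Rat.cast_pow, Rat.cast_div, Rat.cast_one, Rat.cast_ofNat] using
      (Rat.cast_le (K := ℝ)).2 hkraft
  calc ∑ n ∈ Finset.range N, (2 : ℝ) ^ (-a n)
      ≤ ∑ n ∈ Finset.range N, 2 ^ c * (1 / 2 : ℝ) ^ (p n).length :=
        Finset.sum_le_sum fun n _ => by
          rw [one_div, inv_pow, ← zpow_natCast, ← zpow_natCast, ← zpow_neg,
            ← zpow_add₀ two_ne_zero]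
          exact zpow_le_zpow_right₀ one_le_two (by have := hpa n; omega)
    _ ≤ 2 ^ c := by
        rw [← Finset.mul_sum]
        exact mul_le_of_le_one_right (by positivity) hkraft

theorem card_le_two_pow_of_length_lt {S : Finset (List Bool)} {g : ℕ}
    (hS : ∀ v ∈ S, v.length < g) : S.card ≤ 2 ^ g := by
  rw [Finset.card_eq_sum_card_fiberwise (f := List.length) (t := Finset.range g)
    fun v hv => Finset.mem_coe.2 (Finset.mem_range.2 (hS v hv))]
  refine (Finset.sum_le_sum fun l _ => ?_).trans
    (Nat.geomSum_lt le_rfl fun l => Finset.mem_range.1).le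
  simpa only [Fintype.card_bool] using Finset.card_filter_length_eq_le (T := S) (s := l)

-- A program of `out i` followed by a plain program shorter than `g i` padded to this length.
theorem IsRequestSet.prepend {ι : Type*} [Primcodable ι] {R : ι → Prop} {len out g : ι → ℕ}
    (h : IsRequestSet R len out) (hD : Partrec D) (hg : IsComputable g) :
    IsRequestSet (fun x : ι × List Bool × ℕ => R x.1 ∧ x.2.2 ∈ D x.2.1 ∧ x.2.1.length < g x.1)
      (fun x => len x.1 + g x.1) fun x => x.2.2 where
  rePred := rePred_and (rePred_comp h.rePred (by fun_prop)) (rePred_and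
    (rePred_comp (f := fun x : ι × List Bool × ℕ => x.2) (rePred_mem hD) (by fun_prop))
    (rePred_of_decide (by fun_prop)))
  computable_len := by have := h.computable_len; fun_prop
  computable_out := by fun_prop
  kraft S hS := by
    classical
    refine (sum_le_sum_image_fst (f := fun i => (1 / 2 : ℚ) ^ len i)
      (g := fun i _ => (1 / 2 : ℚ) ^ (len i + g i)) fun i T hT => ?_).trans
      (h.kraft _ fun i hi => ?_)
    · have hinj : Set.InjOn Prod.fst (T : Set (List Bool × ℕ)) := fun x hx y hy hxy =>
        Prod.ext hxy (Part.mem_unique (hS _ (hT x hx)).2.1 (hxy ▸ (hS _ (hT y hy)).2.1))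
      have hcard : T.card ≤ 2 ^ g i := by
        rw [← Finset.card_image_of_injOn hinj]
        exact card_le_two_pow_of_length_lt
          (Finset.forall_mem_image.2 fun x hx => (hS _ (hT x hx)).2.2)
      calc ∑ _ ∈ T, (1 / 2 : ℚ) ^ (len i + g i)
          = (1 / 2) ^ len i * (T.card / 2 ^ g i) := by
            rw [Finset.sum_const, nsmul_eq_mul, pow_add, one_div_pow _ (g i)]; ring
        _ ≤ (1 / 2) ^ len i := mul_le_of_le_one_right (by positivity)
            ((div_le_one (by positivity)).2 (by exact_mod_cast hcard))
    · obtain ⟨x, hx, rfl⟩ := Finset.mem_image.1 hi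
      exact (hS x hx).1

theorem exists_busyBeaver_le_of_program (hD : Partrec D) (hP : IsOptimalPrefix P)
    {g : List Bool → ℕ → ℕ} (hg : IsComputable fun x : List Bool × ℕ => g x.1 x.2) :
    ∃ c : ℕ, ∀ p n, n ∈ P p → ∀ t : ℤ, t < g p n →
      busyBeaver D t ≤ busyBeaver P (p.length + g p n + c) := by
  obtain ⟨c, hc⟩ := (hP.isRequestSet.prepend hD hg).exists_program hP
  refine ⟨c, fun p n hn t ht => busyBeaver_le fun N v hN hv => ?_⟩
  obtain ⟨q, hq, hqc⟩ := hc ((p, n), v, N) ⟨hn, hN, by dsimp only; omega⟩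
  exact le_busyBeaver hq (by exact_mod_cast hqc)

theorem exists_busyBeaver_add_le_of_program (hD : Partrec D) (hP : IsOptimalPrefix P) (d : ℕ)
    (h : ∃ c : ℕ, ∀ n, ∃ p, n ∈ P p ∧ (p.length : ℤ) ≤ a n + c) :
    ∃ c : ℕ, ∀ n : ℕ, busyBeaver D (n + d) ≤ busyBeaver P (n + a n + c) := by
  obtain ⟨c, hc⟩ := h
  obtain ⟨c', hc'⟩ := exists_busyBeaver_le_of_program hD hP (g := fun _ n => n + d + 1)
    (by fun_prop)
  refine ⟨c + d + 1 + c', fun n => ?_⟩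
  obtain ⟨p, hp, hpa⟩ := hc n
  exact (hc' p n hp _ (by omega)).trans (busyBeaver_mono (by omega))

theorem exists_busyBeaver_sub_add_le_of_program (hD : Partrec D) (hP : IsOptimalPrefix P) (d : ℕ)
    (h : ∃ c : ℕ, ∀ n, ∃ p, n ∈ P p ∧ (p.length : ℤ) ≤ a n + c) :
    ∃ c : ℕ, ∀ n : ℕ, busyBeaver D ((n - a n).toNat + d) ≤ busyBeaver P (n + c) := by
  obtain ⟨c, hc⟩ := h
  obtain ⟨p₀, hp₀, -⟩ := hc 0
  obtain ⟨c', hc'⟩ := exists_busyBeaver_le_of_program hD hP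
    (g := fun p n => n + c - p.length + d + 1) (by fun_prop)
  refine ⟨c + d + 1 + c' + p₀.length, fun n => ?_⟩
  rcases le_or_gt (a n) n with han | han
  · obtain ⟨p, hp, hpa⟩ := hc n
    exact (hc' p n hp _ (by omega)).trans (busyBeaver_mono (by omega))
  · exact (hc' p₀ 0 hp₀ _ (by omega)).trans (busyBeaver_mono (by omega))

end Coding

end BusyBeaver

theorem mainTheorem3
    (D : List Bool →. ℕ) (hD : IsOptimalPlain D)
    (P : List Bool →. ℕ) (hP : IsOptimalPrefix P)
    (m : ℕ → ℝ) (hm : IsAPriori m)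
    (a : ℕ → ℤ) (ha : UpperSemicomputable (fun n => (a n : ℝ))) :
    List.TFAE [
      ∃ c : ℕ, ∀ n : ℕ, tailModulus m n ≤ busyBeaver P (n + a n + c),
      ∃ c : ℕ, ∀ n : ℕ, busyBeaver D n ≤ tailModulus m (n + a n + c),
      ∃ c : ℕ, ∀ n : ℕ, busyBeaver D n ≤ busyBeaver P (n + a n + c),
      ∃ c : ℕ, ∀ n : ℕ, tailModulus m (n - a n) ≤ busyBeaver P (n + c),
      ∃ c : ℕ, ∀ n : ℕ, busyBeaver D (n - a n) ≤ tailModulus m (n + c),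
      ∃ c : ℕ, ∀ n : ℕ, busyBeaver D (n - a n) ≤ busyBeaver P (n + c),
      Summable (fun n : ℕ => (2 : ℝ) ^ (-a n)),
      ∃ c : ℕ, ∀ n : ℕ, ∃ k : ℕ, complexity P n = k ∧ (k : ℤ) - c ≤ a n] := by
  simp only [sub_le_iff_le_add, exists_complexity_eq_and_le_iff]
  obtain ⟨d, hd⟩ := exists_tailModulus_le_busyBeaver hD hm
  obtain ⟨c', hc'⟩ := exists_busyBeaver_le_tailModulus hP hm
  have plainForces := forcesSummable_busyBeaver_tailModulus hD hm
  have tailForces := forcesSummable_tailModulus_busyBeaver hP hm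
  have tail_mono : Monotone (tailModulus m) := fun _ _ => tailModulus_mono m
  tfae_have 7 → 8 := exists_program_le_of_summable hP ha
  tfae_have 8 → 7 := summable_of_program_le hP
  tfae_have 8 → 3 := fun h => by simpa using exists_busyBeaver_add_le_of_program hD.1 hP 0 h
  tfae_have 8 → 1 := fun h => (exists_busyBeaver_add_le_of_program hD.1 hP d h).imp
    fun c hc n => (hd n).trans (hc n)
  tfae_have 8 → 6 := fun h => (exists_busyBeaver_sub_add_le_of_program hD.1 hP 0 h).imp
    fun c hc n => (busyBeaver_mono (by omega)).trans (hc n)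
  tfae_have 8 → 4 := fun h => (exists_busyBeaver_sub_add_le_of_program hD.1 hP d h).imp
    fun c hc n => (hd _).trans (hc n)
  tfae_have 3 → 2 := fun ⟨c, hc⟩ =>
    ⟨c + c', fun n => (hc n).trans ((hc' _).trans (tail_mono (by omega)))⟩
  tfae_have 6 → 5 := fun ⟨c, hc⟩ =>
    ⟨c + c', fun n => (hc n).trans ((hc' _).trans (tail_mono (by omega)))⟩
  tfae_have 1 → 7 := summable_of_le_add tailForces (fun _ _ => busyBeaver_mono) ha
  tfae_have 2 → 7 := summable_of_le_add plainForces tail_mono ha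
  tfae_have 4 → 7 := summable_of_sub_le tailForces tail_mono ha
  tfae_have 5 → 7 := summable_of_sub_le plainForces (fun _ _ => busyBeaver_mono) ha
  tfae_finish
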